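/- Let $0\le D\le 4$ be an integer, $\Omega>0$, $m,\lambda\in\mathbb R$ (with $m\neq0$ if $D=0$) and $M>1$. Consider the $\phi^4$ theory with harmonic term $S(\phi)=\int d^Dx\,\big(\tfrac12(\partial_\mu\phi)^2+\tfrac{\Omega^2}{2}x^2\phi^2+\tfrac{m^2}{2}\phi^2+\lambda\phi^4\big)$ on $\mathbb R^D$. For a set $T\subseteq(0,\infty)$ put $$\hat C_T(p,q)=\Big(\frac{2\pi}{\Omega}\Big)^{D/2}\int_T dt\,\frac{e^{-m^2t}}{\sinh^{D/2}(2\Omega t)}\exp\Big(-\frac{1}{4\Omega}\coth(\Omega t)(p+q)^2-\frac1{4\Omega}\tanh(\Omega t)(p-q)^2\Big).$$ The momentum-space propagator with ultraviolet cutoff $\rho\in\mathbb N$ is $\hat C_\rho=\hat C_{(M^{-2\rho},\infty)}$. It is the sum $\hat C_\rho=\sum_{i=0}^\rho\hat C^i$ of the slices $\hat C^0=\hat C_{(1,\infty)}$ and $\hat C^i=\hat C_{(M^{-2i},M^{-2(i-1)}]}$ for $i\ge1$. Let $G$ be a connected amputated Feynman graph of this theory: a finite graph (tadpoles and multiple lines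 allowed) with vertex set $\mathcal V(G)$ of $n$ vertices, set $\mathcal I(G)$ of $I$ internal lines and $N>0$ external legs, in which every vertex has valence four. For a subgraph $H$ (a set of vertices of $G$ together with a set of internal lines of $G$ whose ends are among these vertices) with $n(H)$ vertices, let $N(H)$ be the number of its external legs, i.e. of the half-lines at vertices of $H$ that do not belong to internal lines of $H$, and let $$\omega(H)=(4-D)\,n(H)+\tfrac12(D-2)\,N(H)-D .$$ Assume that $G$ is strongly convergent, i.e. $\omega(H)>0$ for every connected subgraph $H$ of $G$ having at least one internal line. For $\varphi_1,\dots,\varphi_N\in\mathcal S(\mathbb R^D)$, with $\hat\varphi(p)=\int d^Dx\,\varphi(x)e^{-ipx}$, and an attribution $\mu=(i_\ell)_{\ell\in\mathcal I(G)}\in\mathbb N^{\mathcal I(G)}$, set $$\mathcal A_G^\mu=\int\prod_{e=1}^N d^Dk_e\,\hat\varphi_e(k_e)\prod_{\ell\in\mathcal I(G)}d^Dp_\ell\,d^Dq_\ell\,\hat C^{i_\ell}(p_\ell,q_\ell)\;\prod_{\nu\in\mathcal V(G)}\delta(\text{sum of the four momenta incoming at }\nu),$$ where $p_\ell,q_\ell$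 are the momenta at the two ends of $\ell$ and $k_e$ is the momentum of the external leg $e$. Let $c=\big(\lambda/(2\pi)^{3D}\big)^{n}\big((2\pi)^{D}\big)^{I}$, and let $\mathcal A_{G,\rho}$ be $c$ times the same integral with every $\hat C^{i_\ell}$ replaced by $\hat C_\rho$. Then there is a constant $K>0$, depending on $G,D,\Omega,m,\lambda,M$ but neither on $\rho$ nor on the $\varphi_j$, such that for all $\varphi_1,\dots,\varphi_N\in\mathcal S(\mathbb R^D)$: all the integrals above converge absolutely; the sum over all scale attributions $\mathcal A_G=c\sum_{\mu}\mathcal A_G^\mu$ converges absolutely; $\mathcal A_G=\lim_{\rho\to\infty}\mathcal A_{G,\rho}$; and $$|\mathcal A_{G,\rho}|\ (\rho\in\mathbb N),\ \ |\mathcal A_G|\ \le\ K\,\|\hat\varphi_1\|_1\cdots\|\hat\varphi_{N-2}\|_1\,\|\hat\varphi_{N-1}\|_2\,\|\hat\varphi_N\|_2 .$$ -/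

import Mathlib

open MeasureTheory Filter Topology
open scoped SchwartzMap

noncomputable section

/-- Position and momentum space `ℝ^D` with the Euclidean norm. -/
abbrev MomentumSpace (D : ℕ) : Type := EuclideanSpace ℝ (Fin D)

/-- The Fourier transform with the convention `f̂(p) = ∫ f(x) e^{-i p·x} dx`. -/
def fourierHat {D : ℕ} (f : 𝓢(MomentumSpace D, ℂ)) (p : MomentumSpace D) : ℂ :=
  ∫ x : MomentumSpace D, f x * Complex.exp (-(Complex.I * ((inner ℝ p x : ℝ) : ℂ)))

/-! ### Graphs of the `φ⁴` theory -/

/-- An amputated Feynman graph of the `φ⁴` theory, with `numVert` vertices, `numLines` internal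
lines and `numLegs` external legs. Each vertex has four slots; `hook` says into which slot each of
the two ends of every internal line, and every external leg, is plugged, and each slot is used
exactly once. Tadpoles and multiple lines are allowed. -/
structure Phi4Graph where
  numVert : ℕ
  numLines : ℕ
  numLegs : ℕ
  hook : (Fin numLines × Bool) ⊕ Fin numLegs ≃ Fin numVert × Fin 4

namespace Phi4Graph

/-- The vertex to which the end `b` of the internal line `l` is hooked. -/
def lineEnd (G : Phi4Graph) (l : Fin G.numLines) (b : Bool) : Fin G.numVert :=
  (G.hook (Sum.inl (l, b))).1

/-- A subgraph: a set of vertices and a set of internal lines with both ends among them. -/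
structure Subgraph (G : Phi4Graph) where
  verts : Finset (Fin G.numVert)
  lines : Finset (Fin G.numLines)
  lineEnd_mem : ∀ l ∈ lines, ∀ b : Bool, G.lineEnd l b ∈ verts

/-- The graph seen as a subgraph of itself. -/
def whole (G : Phi4Graph) : G.Subgraph where
  verts := Finset.univ
  lines := Finset.univ
  lineEnd_mem := fun _ _ _ => Finset.mem_univ _

namespace Subgraph

variable {G : Phi4Graph}

/-- Two distinct vertices of `H` are adjacent when some line of `H` joins them. -/
def toSimpleGraph (H : G.Subgraph) : SimpleGraph H.verts :=
  SimpleGraph.fromRel fun u v : H.verts =>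
    ∃ l ∈ H.lines, G.lineEnd l false = u.1 ∧ G.lineEnd l true = v.1

/-- `H` is connected (in particular it has a vertex). -/
def IsConnected (H : G.Subgraph) : Prop := H.toSimpleGraph.Connected

/-- The number `N(H)` of external legs of `H`: the slots of vertices of `H` that are not filled by
an end of an internal line of `H`. -/
def numLegs (H : G.Subgraph) : ℕ :=
  (Finset.univ.filter fun s : Fin G.numVert × Fin 4 =>
    s.1 ∈ H.verts ∧ ∀ l ∈ H.lines, ∀ b : Bool, G.hook (Sum.inl (l, b)) ≠ s).card

/-- The superficial degree of divergence `ω(H) = (4 - D) n(H) + (D - 2) N(H) / 2 - D`. -/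
def degree (D : ℕ) (H : G.Subgraph) : ℚ :=
  (4 - (D : ℚ)) * (H.verts.card : ℚ) + ((D : ℚ) - 2) / 2 * (H.numLegs : ℚ) - (D : ℚ)

end Subgraph

/-- `G` is connected. -/
def IsConnected (G : Phi4Graph) : Prop := G.whole.IsConnected

/-- Strong convergence: `ω(H) > 0` for each connected subgraph `H` having an internal line.
(A bare vertex has `ω = 0` in every dimension and is not counted as a subgraph here.) -/
def StronglyConvergent (D : ℕ) (G : Phi4Graph) : Prop :=
  ∀ H : G.Subgraph, H.IsConnected → H.lines.Nonempty → 0 < H.degree D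

end Phi4Graph

/-! ### The propagator -/

/-- `Ĉ(t, p, q)`, the integrand over `t` of the propagator in momentum space. -/
def propagatorDensity {D : ℕ} (Ω m t : ℝ) (p q : MomentumSpace D) : ℝ :=
  Real.exp (-(m ^ 2 * t)) / Real.sinh (2 * Ω * t) ^ ((D : ℝ) / 2) *
    Real.exp (-(1 / (4 * Ω) * (Real.cosh (Ω * t) / Real.sinh (Ω * t)) * ‖p + q‖ ^ 2)
      - 1 / (4 * Ω) * Real.tanh (Ω * t) * ‖p - q‖ ^ 2)

/-- The part `(2π/Ω)^{D/2} ∫_T Ĉ(t, p, q) dt` of the propagator coming from a set `T` of times. -/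
def propagatorOn {D : ℕ} (Ω m : ℝ) (T : Set ℝ) (p q : MomentumSpace D) : ℝ :=
  (2 * Real.pi / Ω) ^ ((D : ℝ) / 2) * ∫ t in T, propagatorDensity Ω m t p q

/-- The times of the slice of scale `i`: `(1, ∞)` if `i = 0`, and `(M^{-2i}, M^{-2(i-1)}]`
if `i ≥ 1`. -/
def sliceTimes (M : ℝ) : ℕ → Set ℝ
  | 0 => Set.Ioi 1
  | i + 1 => Set.Ioc ((M ^ (2 * (i + 1)))⁻¹) ((M ^ (2 * i))⁻¹)

/-- The slice `Ĉ^i` of the propagator. -/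
def propagatorSlice {D : ℕ} (Ω m M : ℝ) (i : ℕ) (p q : MomentumSpace D) : ℝ :=
  propagatorOn Ω m (sliceTimes M i) p q

/-- The propagator `Ĉ_ρ` with ultraviolet cutoff `ρ`. -/
def propagatorCutoff {D : ℕ} (Ω m M : ℝ) (ρ : ℕ) (p q : MomentumSpace D) : ℝ :=
  propagatorOn Ω m (Set.Ioi ((M ^ (2 * ρ))⁻¹)) p q

/-! ### Amplitudes -/

namespace Phi4Graph

variable {D : ℕ}

/-- The momenta incoming at the four slots of each vertex, when the vertex delta functions are
solved. Every end of a line and every leg carries its own momentum, so the factors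
`δ(p₀ + p₁ + p₂ + p₃)` of distinct vertices involve disjoint sets of variables, and each of them is
the Lebesgue measure `dp₁ dp₂ dp₃` with `p₀ = -(p₁ + p₂ + p₃)`. -/
def slotMomentum (G : Phi4Graph) (P : Fin G.numVert → Fin 3 → MomentumSpace D)
    (s : Fin G.numVert × Fin 4) : MomentumSpace D :=
  Matrix.vecCons (-∑ j, P s.1 j) (P s.1) s.2

/-- The momentum at the end `b` of the internal line `l`. -/
def lineMomentum (G : Phi4Graph) (P : Fin G.numVert → Fin 3 → MomentumSpace D)
    (l : Fin G.numLines) (b : Bool) : MomentumSpace D :=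
  G.slotMomentum P (G.hook (Sum.inl (l, b)))

/-- The momentum `k_e` of the external leg `e`. -/
def legMomentum (G : Phi4Graph) (P : Fin G.numVert → Fin 3 → MomentumSpace D)
    (e : Fin G.numLegs) : MomentumSpace D :=
  G.slotMomentum P (G.hook (Sum.inr e))

/-- The Feynman integrand `∏_l C_l(p_l, q_l) ∏_e φ̂_e(k_e)` on the momenta conserved at every vertex,
for given propagators `C_l` of the internal lines. -/
def integrand (G : Phi4Graph) (C : Fin G.numLines → MomentumSpace D → MomentumSpace D → ℝ)
    (φ : Fin G.numLegs → 𝓢(MomentumSpace D, ℂ))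
    (P : Fin G.numVert → Fin 3 → MomentumSpace D) : ℂ :=
  (∏ l, ((C l (G.lineMomentum P l false) (G.lineMomentum P l true) : ℝ) : ℂ)) *
    ∏ e, fourierHat (φ e) (G.legMomentum P e)

/-- The Feynman integral
`∫ ∏_e dk_e φ̂_e(k_e) ∫ ∏_l dp_l dq_l C_l(p_l, q_l) Δ({p_l, q_l, k_e})`. -/
def feynmanIntegral (G : Phi4Graph)
    (C : Fin G.numLines → MomentumSpace D → MomentumSpace D → ℝ)
    (φ : Fin G.numLegs → 𝓢(MomentumSpace D, ℂ)) : ℂ :=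
  ∫ P : Fin G.numVert → Fin 3 → MomentumSpace D, G.integrand C φ P

/-- The constant factors of the Feynman rules: `lam / (2π)^{3D}` for each vertex and `(2π)^D` for
each internal line. -/
def prefactor (G : Phi4Graph) (D : ℕ) (lam : ℝ) : ℝ :=
  (lam / (2 * Real.pi) ^ (3 * D)) ^ G.numVert * ((2 * Real.pi) ^ D) ^ G.numLines

/-- The amplitude of the attribution `μ` of scales to the internal lines (without prefactor),
smeared with `φ̂_1, …, φ̂_N`. -/
def attributionAmplitude (G : Phi4Graph) (Ω m M : ℝ) (μ : Fin G.numLines → ℕ)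
    (φ : Fin G.numLegs → 𝓢(MomentumSpace D, ℂ)) : ℂ :=
  G.feynmanIntegral (fun l => propagatorSlice Ω m M (μ l)) φ

/-- The amplitude with cutoff `ρ`, smeared with `φ̂_1, …, φ̂_N`. -/
def cutoffAmplitude (G : Phi4Graph) (Ω m lam M : ℝ) (ρ : ℕ)
    (φ : Fin G.numLegs → 𝓢(MomentumSpace D, ℂ)) : ℂ :=
  (G.prefactor D lam : ℂ) * G.feynmanIntegral (fun _ => propagatorCutoff Ω m M ρ) φ

/-- The full amplitude, summed over all attributions of scales, smeared with `φ̂_1, …, φ̂_N`. -/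
def fullAmplitude (G : Phi4Graph) (Ω m lam M : ℝ)
    (φ : Fin G.numLegs → 𝓢(MomentumSpace D, ℂ)) : ℂ :=
  (G.prefactor D lam : ℂ) * ∑' μ : Fin G.numLines → ℕ, G.attributionAmplitude Ω m M μ φ

end Phi4Graph

/-- `‖φ̂_1‖₁ ⋯ ‖φ̂_{N-2}‖₁ ‖φ̂_{N-1}‖₂ ‖φ̂_N‖₂` (legs are numbered from `0` in `Fin N`). -/
def legNorms {D N : ℕ} (φ : Fin N → 𝓢(MomentumSpace D, ℂ)) : ℝ :=
  ∏ e : Fin N,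
    (eLpNorm (fourierHat (φ e)) (if (e : ℕ) + 2 < N then 1 else 2) volume).toReal

end

/-!
The proof is a multiscale power counting in momentum space, and all of it is carried out on absolute
values: everything follows once the sum over the scale attributions of the integrals of
`‖integrand‖` is bounded by a constant times `legNorms`, for the amplitude with cutoff `ρ` is a
finite partial sum of the series of attributions.

Write `s = M ^ i`. On the slice of scale `i` the propagator is at most
`s⁻² * (s ^ D * exp (-κ s² ‖p + q‖²)) * exp (-κ s⁻² ‖p - q‖²)` up to a constant
(`exists_propagatorSlice_le`). The Gaussian in the total momentum `p + q` is normalized. As momentum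
is not conserved along the lines, all the `p + q` are independent variables, and they can be
integrated at no cost; only the overall conservation remains, and it fixes one external momentum.
The Gaussian in the relative momentum `p - q` is needed only on a set `B` of lines that carries the loop
momenta, where it costs a factor `s ^ D`. The linear change of variables to these coordinates is
bijective (`adaptedCoordinates_injective`, `finrank_adaptedCoordinates`), so its Jacobian is a
constant, and the external legs are controlled by the Cauchy-Schwarz inequality for two of them and
by `L¹` norms for the others (`exists_lintegral_le_of_isLoopSet`).

An attribution `μ` is therefore bounded by `M` to the power `D * ∑ l ∈ B, μ l - 2 * ∑ l, μ l` for
any such `B`. Choosing `B` greedily, with the loop momenta on lines of scales as low as possible, the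
lines of scale at least `i` contain no more elements of `B` than they form loops
(`exists_isLoopSet`). By Euler's formula `2 I - D (I - n + 1)` is the degree `ω` of a connected
subgraph, so strong convergence makes each scale `1 ≤ i ≤ max μ` contribute at least one factor
`M⁻¹` (`mul_finrank_cycleSpace_lt`, `exists_isLoopSet_powerCounting`). The resulting decay
`M ^ (-max μ)` is summable over all attributions, as it is at most a product of geometric sequences
in the `μ l`.
-/

/-! ### Power counting of subgraphs -/

namespace Phi4Graph

open Finset

theorem two_mul_numLines_add_numLegs (G : Phi4Graph) :
    2 * G.numLines + G.numLegs = 4 * G.numVert := by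
  have h := Fintype.card_congr G.hook
  simp only [Fintype.card_sum, Fintype.card_prod, Fintype.card_fin, Fintype.card_bool] at h
  omega

/-- Every slot of a vertex of `H` is either external or the place of one of the two ends of a line
of `H`. -/
theorem Subgraph.numLegs_add {G : Phi4Graph} (H : G.Subgraph) :
    H.numLegs + 2 * H.lines.card = 4 * H.verts.card := by
  classical
  have hslots : (univ.filter fun s : Fin G.numVert × Fin 4 => s.1 ∈ H.verts).card
      = 4 * H.verts.card := by
    have : (univ.filter fun s : Fin G.numVert × Fin 4 => s.1 ∈ H.verts) = H.verts ×ˢ univ := by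
      ext s; simp
    rw [this, card_product, card_univ, Fintype.card_fin, mul_comm]
  have hfilled : ((H.lines ×ˢ (univ : Finset Bool)).image fun x => G.hook (Sum.inl x)).card
      = 2 * H.lines.card := by
    rw [card_image_of_injective _ fun x y h => Sum.inl_injective (G.hook.injective h), card_product,
      card_univ, Fintype.card_bool, mul_comm]
  rw [← hslots, ← hfilled, Subgraph.numLegs, ← card_union_of_disjoint]
  · congr 1
    ext s
    simp only [mem_union, mem_filter, mem_univ, true_and, mem_image, mem_product, and_true,
      Prod.exists]
    constructor
    · rintro (⟨h, -⟩ | ⟨l, b, hl, rfl⟩)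
      · exact h
      · exact H.lineEnd_mem l hl b
    · intro h
      by_cases hs : ∀ l ∈ H.lines, ∀ b : Bool, G.hook (Sum.inl (l, b)) ≠ s
      · exact Or.inl ⟨h, hs⟩
      · push Not at hs
        obtain ⟨l, hl, b, hb⟩ := hs
        exact Or.inr ⟨l, b, hl, hb⟩
  · rw [disjoint_left]
    intro s hs hs'
    simp only [mem_filter, mem_univ, true_and] at hs
    simp only [mem_image, mem_product, mem_univ, and_true, Prod.exists] at hs'
    obtain ⟨l, b, hl, rfl⟩ := hs'
    exact hs.2 l hl b rfl

/-- `ω(H) = 2 I(H) - D (I(H) - n(H) + 1)`: each line of a connected `H` yields two powers of its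
scale, and each independent loop costs `D`. -/
theorem Subgraph.degree_eq (D : ℕ) {G : Phi4Graph} (H : G.Subgraph) :
    H.degree D = 2 * H.lines.card - D * ((H.lines.card : ℚ) - H.verts.card + 1) := by
  have h : (H.numLegs : ℚ) + 2 * H.lines.card = 4 * H.verts.card := by
    exact_mod_cast H.numLegs_add
  have h' : (H.numLegs : ℚ) = 4 * H.verts.card - 2 * H.lines.card := by linarith
  rw [Subgraph.degree, h']
  ring

/-! ### Spaces of loop momenta -/

variable (G : Phi4Graph)

/-- The simple graph on all vertices of `G` whose edges are the lines in `S`. -/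
def lineGraph (S : Finset (Fin G.numLines)) : SimpleGraph (Fin G.numVert) :=
  SimpleGraph.fromRel fun u v => ∃ l ∈ S, G.lineEnd l false = u ∧ G.lineEnd l true = v

theorem lineGraph_reachable {S : Finset (Fin G.numLines)} {l : Fin G.numLines} (hl : l ∈ S) :
    (G.lineGraph S).Reachable (G.lineEnd l false) (G.lineEnd l true) := by
  by_cases h : G.lineEnd l false = G.lineEnd l true
  · rw [h]
  · apply SimpleGraph.Adj.reachable
    rw [lineGraph, SimpleGraph.fromRel_adj]
    exact ⟨h, Or.inl ⟨l, hl, rfl, rfl⟩⟩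

/-- The space of loop momenta of the set `S` of lines (its cycle space): the momenta `x l`, flowing
along each line `l` of `S` into the vertex of its end `false` and out of that of its end `true`,
which are conserved at every vertex. -/
noncomputable def cycleSpace (S : Finset (Fin G.numLines)) : Submodule ℝ (Fin G.numLines → ℝ) where
  carrier := {x | (∀ l ∉ S, x l = 0) ∧ ∀ v, ∑ l, x l *
    ((if G.lineEnd l false = v then 1 else 0) - (if G.lineEnd l true = v then 1 else 0)) = 0}
  add_mem' := by
    rintro x y ⟨hx, hx'⟩ ⟨hy, hy'⟩
    refine ⟨fun l hl => by simp [hx l hl, hy l hl], fun v => ?_⟩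
    simp only [Pi.add_apply, add_mul, sum_add_distrib, hx' v, hy' v, add_zero]
  zero_mem' := by simp
  smul_mem' := by
    rintro c x ⟨hx, hx'⟩
    refine ⟨fun l hl => by simp [hx l hl], fun v => ?_⟩
    simp only [Pi.smul_apply, smul_eq_mul, mul_assoc, ← mul_sum, hx' v, mul_zero]

theorem cycleSpace_mono {S T : Finset (Fin G.numLines)} (h : S ⊆ T) :
    G.cycleSpace S ≤ G.cycleSpace T :=
  fun _ hx => ⟨fun l hl => hx.1 l fun h' => hl (h h'), hx.2⟩

open Classical in
/-- Euler's bound on the number of independent loops, `b₁ ≤ I - n + c`: the incidence matrix and its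
transpose have the same rank, and a vector killed by the transpose is constant on each
component. -/
theorem finrank_cycleSpace_add_le (S : Finset (Fin G.numLines)) :
    Module.finrank ℝ (G.cycleSpace S) + G.numVert ≤
      S.card + Fintype.card (G.lineGraph S).ConnectedComponent := by
  let A : Matrix (Fin G.numVert) S ℝ := fun v l =>
    (if G.lineEnd l false = v then 1 else 0) - (if G.lineEnd l true = v then 1 else 0)
  have h1 : Module.finrank ℝ (G.cycleSpace S) ≤ Module.finrank ℝ (LinearMap.ker A.mulVecLin) := by
    let f : G.cycleSpace S →ₗ[ℝ] LinearMap.ker A.mulVecLin :=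
      LinearMap.codRestrict _
        ((LinearMap.funLeft ℝ ℝ ((↑) : S → Fin G.numLines)).comp (G.cycleSpace S).subtype) (by
          rintro ⟨x, hx, hx'⟩
          rw [LinearMap.mem_ker]
          ext v
          simp only [LinearMap.comp_apply, Submodule.subtype_apply, Matrix.mulVecLin_apply,
            Matrix.mulVec, dotProduct, LinearMap.funLeft_apply, Pi.zero_apply]
          rw [← hx' v, ← sum_subset (subset_univ S)
            (fun l _ hl => by rw [hx l hl, zero_mul]), ← sum_coe_sort S]
          exact sum_congr rfl fun l _ => mul_comm _ _)
    refine LinearMap.finrank_le_finrank_of_injective (f := f) ?_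
    intro x y hxy
    ext l
    by_cases hl : l ∈ S
    · exact congrFun (congrArg Subtype.val hxy) ⟨l, hl⟩
    · rw [x.2.1 l hl, y.2.1 l hl]
  have h2 : Module.finrank ℝ (LinearMap.ker A.transpose.mulVecLin) ≤
      Fintype.card (G.lineGraph S).ConnectedComponent := by
    let f : LinearMap.ker A.transpose.mulVecLin →ₗ[ℝ]
        ((G.lineGraph S).ConnectedComponent → ℝ) :=
      (LinearMap.funLeft ℝ ℝ (fun c : (G.lineGraph S).ConnectedComponent => Quot.out c)).comp
        (Submodule.subtype _)
    rw [← Module.finrank_fintype_fun_eq_card ℝ]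
    refine LinearMap.finrank_le_finrank_of_injective (f := f) ?_
    -- A vector in the kernel of the transpose takes the same value at the two ends of a line.
    have hline : ∀ x ∈ LinearMap.ker A.transpose.mulVecLin, ∀ l ∈ S,
        x (G.lineEnd l false) = x (G.lineEnd l true) := by
      intro x hx l hl
      have := congrFun (LinearMap.mem_ker.1 hx) ⟨l, hl⟩
      have hA : ∀ v, A.transpose ⟨l, hl⟩ v =
        (if G.lineEnd l false = v then 1 else 0) - (if G.lineEnd l true = v then 1 else 0) :=
          fun _ => rfl
      simp only [Matrix.mulVecLin_apply, Matrix.mulVec, dotProduct, hA, sub_mul, ite_mul, one_mul,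
        zero_mul, sum_sub_distrib, sum_ite_eq, mem_univ, if_true, Pi.zero_apply] at this
      linarith
    have hreach : ∀ x ∈ LinearMap.ker A.transpose.mulVecLin, ∀ u v,
        (G.lineGraph S).Reachable u v → x u = x v := by
      intro x hx u v huv
      rw [SimpleGraph.reachable_iff_reflTransGen] at huv
      induction huv with
      | refl => rfl
      | tail _ h ih =>
        rw [ih]
        rw [lineGraph, SimpleGraph.fromRel_adj] at h
        obtain ⟨-, ⟨l, hl, rfl, rfl⟩ | ⟨l, hl, rfl, rfl⟩⟩ := h
        · exact hline x hx l hl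
        · exact (hline x hx l hl).symm
    intro x y hxy
    ext v
    have hv : (G.lineGraph S).Reachable
        (Quot.out ((G.lineGraph S).connectedComponentMk v)) v :=
      SimpleGraph.ConnectedComponent.exact (Quot.out_eq _)
    rw [← hreach x x.2 _ _ hv, ← hreach y y.2 _ _ hv]
    exact congrFun hxy ((G.lineGraph S).connectedComponentMk v)
  have h3 := A.mulVecLin.finrank_range_add_finrank_ker
  have h4 := A.transpose.mulVecLin.finrank_range_add_finrank_ker
  have h5 := A.rank_transpose
  rw [Matrix.rank, Matrix.rank] at h5
  simp only [Module.finrank_fintype_fun_eq_card, Fintype.card_coe, Fintype.card_fin] at h3 h4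
  omega

open Classical in
/-- The connected component `c` of the set `S` of lines, as a subgraph. -/
noncomputable def componentSubgraph (S : Finset (Fin G.numLines))
    (c : (G.lineGraph S).ConnectedComponent) :
    G.Subgraph where
  verts := univ.filter fun v => (G.lineGraph S).connectedComponentMk v = c
  lines := S.filter fun l => (G.lineGraph S).connectedComponentMk (G.lineEnd l false) = c
  lineEnd_mem := by
    intro l hl b
    rw [mem_filter] at hl ⊢
    refine ⟨mem_univ _, ?_⟩
    rw [← hl.2]
    cases b
    · rfl
    · exact (SimpleGraph.ConnectedComponent.sound (G.lineGraph_reachable hl.1)).symm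

theorem isConnected_componentSubgraph (S : Finset (Fin G.numLines))
    (c : (G.lineGraph S).ConnectedComponent) : (G.componentSubgraph S c).IsConnected := by
  classical
  have key : ∀ u v, (G.lineGraph S).Reachable u v → ∀ hu : u ∈ (G.componentSubgraph S c).verts,
      ∃ hv : v ∈ (G.componentSubgraph S c).verts,
        (G.componentSubgraph S c).toSimpleGraph.Reachable ⟨u, hu⟩ ⟨v, hv⟩ := by
    intro u v huv hu
    rw [SimpleGraph.reachable_iff_reflTransGen] at huv
    induction huv with
    | refl => exact ⟨hu, .rfl⟩
    | @tail v w _ h ih =>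
      obtain ⟨hv, ih⟩ := ih
      have hvw := SimpleGraph.ConnectedComponent.sound h.reachable
      have hvc : (G.lineGraph S).connectedComponentMk v = c := (mem_filter.1 hv).2
      have hwc : (G.lineGraph S).connectedComponentMk w = c := hvw ▸ hvc
      refine ⟨mem_filter.2 ⟨mem_univ _, hwc⟩, ih.trans (SimpleGraph.Adj.reachable ?_)⟩
      rw [lineGraph, SimpleGraph.fromRel_adj] at h
      rw [Subgraph.toSimpleGraph, SimpleGraph.fromRel_adj]
      refine ⟨fun h' => h.1 (congrArg Subtype.val h'), ?_⟩
      obtain ⟨-, ⟨l, hl, h1, h2⟩ | ⟨l, hl, h1, h2⟩⟩ := h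
      · exact Or.inl ⟨l, mem_filter.2 ⟨hl, by rw [h1, hvc]⟩, h1, h2⟩
      · exact Or.inr ⟨l, mem_filter.2 ⟨hl, by rw [h1, hwc]⟩, h1, h2⟩
  rw [Subgraph.IsConnected, SimpleGraph.connected_iff]
  refine ⟨?_, ?_⟩
  · rintro ⟨u, hu⟩ ⟨v, hv⟩
    have huv : (G.lineGraph S).Reachable u v :=
      SimpleGraph.ConnectedComponent.exact ((mem_filter.1 hu).2.trans (mem_filter.1 hv).2.symm)
    exact (key u v huv hu).2
  · obtain ⟨v, rfl⟩ := c.exists_rep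
    exact ⟨⟨v, mem_filter.2 ⟨mem_univ _, rfl⟩⟩⟩

/-- A connected subgraph without lines is a bare vertex. -/
theorem Subgraph.card_verts_eq_one {G : Phi4Graph} {H : G.Subgraph} (hH : H.IsConnected)
    (hl : H.lines = ∅) : H.verts.card = 1 := by
  obtain ⟨hpre, ⟨v, hv⟩⟩ := (SimpleGraph.connected_iff _).1 hH
  rw [card_eq_one]
  refine ⟨v, eq_singleton_iff_unique_mem.2 ⟨hv, fun u hu => ?_⟩⟩
  have h := (SimpleGraph.reachable_iff_reflTransGen _ _).1 (hpre ⟨v, hv⟩ ⟨u, hu⟩)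
  rcases h.cases_tail with h | ⟨w, -, h⟩
  · exact congrArg Subtype.val h
  · rw [Subgraph.toSimpleGraph, SimpleGraph.fromRel_adj] at h
    simp [hl] at h

/-- In a strongly convergent graph the loops of any nonempty set of lines cost less than its lines
yield: a component which has lines does so with a positive degree, and a bare vertex is neutral. -/
theorem mul_finrank_cycleSpace_lt {D : ℕ} {G : Phi4Graph} (hconv : G.StronglyConvergent D)
    {S : Finset (Fin G.numLines)} (hS : S.Nonempty) :
    D * Module.finrank ℝ (G.cycleSpace S) < 2 * S.card := by
  classical
  have hV : (G.numVert : ℚ) = ∑ c, ((G.componentSubgraph S c).verts.card : ℚ) := by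
    have := card_eq_sum_card_fiberwise (s := (univ : Finset (Fin G.numVert)))
      (f := (G.lineGraph S).connectedComponentMk) (t := univ) (fun _ _ => mem_coe.2 (mem_univ _))
    rw [card_univ, Fintype.card_fin] at this
    exact_mod_cast this
  have hL : (S.card : ℚ) = ∑ c, ((G.componentSubgraph S c).lines.card : ℚ) := by
    have := card_eq_sum_card_fiberwise (s := S)
      (f := fun l => (G.lineGraph S).connectedComponentMk (G.lineEnd l false)) (t := univ)
      (fun _ _ => mem_coe.2 (mem_univ _))
    exact_mod_cast this
  have hpos : 0 < ∑ c, (G.componentSubgraph S c).degree D := by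
    obtain ⟨l, hl⟩ := hS
    refine sum_pos' (fun c _ => ?_)
      ⟨(G.lineGraph S).connectedComponentMk (G.lineEnd l false), mem_univ _,
        hconv _ (G.isConnected_componentSubgraph S _) ⟨l, mem_filter.2 ⟨hl, rfl⟩⟩⟩
    rcases (G.componentSubgraph S c).lines.eq_empty_or_nonempty with h | h
    · rw [Subgraph.degree_eq, h,
        Subgraph.card_verts_eq_one (G.isConnected_componentSubgraph S c) h]
      simp
    · exact (hconv _ (G.isConnected_componentSubgraph S c) h).le
  have hsum : ∑ c, (G.componentSubgraph S c).degree D = 2 * (S.card : ℚ) -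
      D * (S.card - G.numVert + Fintype.card (G.lineGraph S).ConnectedComponent) := by
    rw [hV, hL]
    simp only [Subgraph.degree_eq, sum_sub_distrib, ← mul_sum, sum_add_distrib, sum_const,
      card_univ, nsmul_eq_mul, mul_one]
  have hle : (Module.finrank ℝ (G.cycleSpace S) : ℚ) + G.numVert ≤
      S.card + Fintype.card (G.lineGraph S).ConnectedComponent := by
    exact_mod_cast G.finrank_cycleSpace_add_le S
  have hle' := mul_le_mul_of_nonneg_left hle (Nat.cast_nonneg (α := ℚ) D)
  have : (D : ℚ) * Module.finrank ℝ (G.cycleSpace S) < 2 * S.card := by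
    rw [hsum] at hpos
    linarith
  exact_mod_cast this

/-- A connected graph has at most `I - n + 1` independent loops. -/
theorem finrank_cycleSpace_univ_add_le {G : Phi4Graph} (hconn : G.IsConnected) :
    Module.finrank ℝ (G.cycleSpace univ) + G.numVert ≤ G.numLines + 1 := by
  classical
  obtain ⟨hpre, ⟨v⟩⟩ := (SimpleGraph.connected_iff _).1 hconn
  have hc : Fintype.card (G.lineGraph univ).ConnectedComponent ≤ 1 := by
    rw [Fintype.card_le_one_iff]
    intro c c'
    obtain ⟨u, rfl⟩ := c.exists_rep
    obtain ⟨u', rfl⟩ := c'.exists_rep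
    apply SimpleGraph.ConnectedComponent.sound
    have h := (SimpleGraph.reachable_iff_reflTransGen _ _).1
      (hpre ⟨u, mem_univ u⟩ ⟨u', mem_univ u'⟩)
    rw [SimpleGraph.reachable_iff_reflTransGen]
    refine h.lift Subtype.val fun a b hab => ?_
    rw [Subgraph.toSimpleGraph, SimpleGraph.fromRel_adj] at hab
    exact (SimpleGraph.fromRel_adj _ _ _).2 ⟨fun h' => hab.1 (Subtype.ext h'), hab.2⟩
  have := G.finrank_cycleSpace_add_le univ
  rw [card_univ, Fintype.card_fin] at this
  omega

/-! ### Loop lines of lowest scales -/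

/-- The lines of `B` can carry the loop momenta of `G`: their momenta determine those of all the
lines, and there are no more of them than loops. -/
def IsLoopSet (B : Finset (Fin G.numLines)) : Prop :=
  B.card ≤ Module.finrank ℝ (G.cycleSpace univ) ∧
    ∀ x ∈ G.cycleSpace univ, (∀ l ∈ B, x l = 0) → x = 0

/-- Loop momenta can be carried by lines of scales as low as possible: among the lines of scale at
least `i` there are no more carriers than loops formed by these lines. The set is built greedily,
by adding the lines in the order of decreasing scales and keeping a line as a carrier when it closes
a loop. -/
theorem exists_isLoopSet (μ : Fin G.numLines → ℕ) :
    ∃ B, G.IsLoopSet B ∧ ∀ i, (B.filter fun l => i ≤ μ l).card ≤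
      Module.finrank ℝ (G.cycleSpace (univ.filter fun l => i ≤ μ l)) := by
  classical
  suffices h : ∀ S : Finset (Fin G.numLines), ∃ B ⊆ S,
      (∀ x ∈ G.cycleSpace S, (∀ l ∈ B, x l = 0) → x = 0) ∧
      ∀ i, (B.filter fun l => i ≤ μ l).card ≤
        Module.finrank ℝ (G.cycleSpace (S.filter fun l => i ≤ μ l)) by
    obtain ⟨B, -, h1, h2⟩ := h univ
    refine ⟨B, ⟨?_, h1⟩, h2⟩
    have h0 := h2 0
    rwa [filter_true_of_mem fun _ _ => Nat.zero_le _,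
      filter_true_of_mem fun _ _ => Nat.zero_le _] at h0
  intro S
  induction S using Finset.induction_on_min_value μ with
  | empty =>
    refine ⟨∅, Subset.rfl, fun x hx _ => ?_, fun i => by simp⟩
    ext l
    exact hx.1 l (notMem_empty l)
  | insert a S ha hmin ih =>
    obtain ⟨B, hBS, hB, hcard⟩ := ih
    -- The line `a` closes a loop with the previous ones exactly when some loop momentum crosses it.
    by_cases hclose : ∃ z ∈ G.cycleSpace (insert a S), z a ≠ 0
    · obtain ⟨z, hz, hza⟩ := hclose
      refine ⟨insert a B, insert_subset_insert a hBS, fun x hx hx0 => ?_, fun i => ?_⟩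
      · refine hB x ⟨fun l hl => ?_, hx.2⟩ fun l hl => hx0 l (mem_insert_of_mem hl)
        by_cases hla : l = a
        · rw [hla]
          exact hx0 a (mem_insert_self a B)
        · exact hx.1 l (by simp [hla, hl])
      · by_cases hi : i ≤ μ a
        · have hall : ∀ T ⊆ S, T.filter (fun l => i ≤ μ l) = T := fun T hT =>
            filter_true_of_mem fun l hl => hi.trans (hmin l (hT hl))
          have h1 := hcard i
          rw [hall B hBS, hall S Subset.rfl] at h1
          rw [filter_insert, if_pos hi, filter_insert, if_pos hi, hall B hBS, hall S Subset.rfl,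
            card_insert_of_notMem (fun h => ha (hBS h))]
          have hlt : G.cycleSpace S < G.cycleSpace (insert a S) :=
            lt_of_le_of_ne (G.cycleSpace_mono (subset_insert a S))
              fun h => hza ((h ▸ hz : z ∈ G.cycleSpace S).1 a ha)
          have := Submodule.finrank_lt_finrank_of_lt hlt
          omega
        · rw [filter_insert, if_neg hi, filter_insert, if_neg hi]
          exact hcard i
    · push Not at hclose
      refine ⟨B, hBS.trans (subset_insert a S), fun x hx hx0 => ?_, fun i => ?_⟩
      · refine hB x ⟨fun l hl => ?_, hx.2⟩ hx0
        by_cases hla : l = a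
        · rw [hla]
          exact hclose x hx
        · exact hx.1 l (by simp [hla, hl])
      · exact (hcard i).trans (Submodule.finrank_mono
          (G.cycleSpace_mono (filter_subset_filter _ (subset_insert a S))))

/-- Power counting of a scale attribution: with the loop momenta on the lines of lowest scales, the
gain of the lines beats the cost of the loops by a whole unit at each scale up to the highest. -/
theorem exists_isLoopSet_powerCounting {D : ℕ} {G : Phi4Graph} (hconv : G.StronglyConvergent D)
    (μ : Fin G.numLines → ℕ) :
    ∃ B, G.IsLoopSet B ∧ ∀ l₀, D * ∑ l ∈ B, μ l + μ l₀ ≤ 2 * ∑ l, μ l := by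
  classical
  obtain ⟨B, hB, hcard⟩ := G.exists_isLoopSet μ
  refine ⟨B, hB, fun l₀ => ?_⟩
  -- `μ l` counts the scales `i` with `1 ≤ i ≤ μ l`, here as `i + 1` with `i < μ l`.
  have hlayer : ∀ T : Finset (Fin G.numLines),
      ∑ l ∈ T, μ l = ∑ i ∈ range (∑ l, μ l), (T.filter fun l => i + 1 ≤ μ l).card := by
    intro T
    simp only [card_filter]
    rw [sum_comm]
    refine sum_congr rfl fun l _ => ?_
    rw [← card_filter]
    have : (range (∑ l, μ l)).filter (fun i => i + 1 ≤ μ l) = range (μ l) := by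
      ext i
      have := single_le_sum (f := μ) (fun _ _ => Nat.zero_le _) (mem_univ l)
      simp only [mem_filter, mem_range]
      omega
    rw [this, card_range]
  have h0 := hlayer {l₀}
  rw [sum_singleton] at h0
  rw [h0, hlayer B]
  conv_rhs => rw [hlayer univ]
  rw [mul_sum, mul_sum, ← sum_add_distrib]
  refine sum_le_sum fun i _ => ?_
  have h1 : D * (B.filter fun l => i + 1 ≤ μ l).card ≤
      D * Module.finrank ℝ (G.cycleSpace (univ.filter fun l => i + 1 ≤ μ l)) :=
    Nat.mul_le_mul_left D (hcard (i + 1))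
  rcases (univ.filter fun l => i + 1 ≤ μ l).eq_empty_or_nonempty with h | h
  · have hB0 : (B.filter fun l => i + 1 ≤ μ l) = ∅ :=
      subset_empty.1 (h ▸ filter_subset_filter _ (subset_univ B))
    have hl0 : (({l₀} : Finset _).filter fun l => i + 1 ≤ μ l) = ∅ :=
      subset_empty.1 (h ▸ filter_subset_filter _ (subset_univ {l₀}))
    rw [hB0, hl0, card_empty, mul_zero]
    exact Nat.zero_le _
  · have h2 := mul_finrank_cycleSpace_lt hconv h
    have h3 : (({l₀} : Finset _).filter fun l => i + 1 ≤ μ l).card ≤ 1 :=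
      (card_le_card (filter_subset _ _)).trans (card_singleton _).le
    omega

end Phi4Graph

/-! ### Bounds on the slices of the propagator -/

section Propagator

open Real Set

theorem sinh_le_mul_exp (x : ℝ) : sinh x ≤ x * exp x := by
  have h := add_one_le_exp (-(2 * x))
  have h' : exp (-x) = exp x * exp (-(2 * x)) := by rw [← exp_add]; ring_nf
  rw [sinh_eq, h']
  nlinarith [exp_pos x]

theorem cosh_le_exp_of_nonneg {x : ℝ} (hx : 0 ≤ x) : cosh x ≤ exp x := by
  have h : exp (-x) ≤ exp x := exp_le_exp.2 (by linarith)
  rw [cosh_eq]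
  linarith

theorem mul_exp_le_sinh {a x : ℝ} (hx : a ≤ x) : (1 - exp (-(2 * a))) / 2 * exp x ≤ sinh x := by
  have h' : exp (-x) = exp x * exp (-(2 * x)) := by rw [← exp_add]; ring_nf
  have h : exp (-(2 * x)) ≤ exp (-(2 * a)) := exp_le_exp.2 (by linarith)
  rw [sinh_eq, h']
  nlinarith [exp_pos x]

/-- The shape of the slice of scale `s`: a Gaussian of width `1 / s` in the total momentum `p + q`
and one of width `s` in the relative momentum `p - q`. -/
noncomputable def scaleGaussian {D : ℕ} (κ s : ℝ) (p q : MomentumSpace D) : ℝ :=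
  exp (-(κ * s ^ 2) * ‖p + q‖ ^ 2) * exp (-(κ * (s ^ 2)⁻¹) * ‖p - q‖ ^ 2)

theorem sliceTimes_subset_Ioi {M : ℝ} (hM : 1 < M) (i : ℕ) : sliceTimes M i ⊆ Ioi 0 := by
  rcases i with _ | i
  · exact Ioi_subset_Ioi zero_le_one
  · exact fun t ht => lt_trans (by positivity) ht.1

theorem measurableSet_sliceTimes (M : ℝ) (i : ℕ) : MeasurableSet (sliceTimes M i) := by
  rcases i with _ | i
  · exact measurableSet_Ioi
  · exact measurableSet_Ioc

theorem propagatorDensity_nonneg {D : ℕ} {Ω m t : ℝ} (hΩ : 0 < Ω) (ht : 0 < t)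
    (p q : MomentumSpace D) : 0 ≤ propagatorDensity Ω m t p q := by
  have : 0 < sinh (2 * Ω * t) := sinh_pos_iff.2 (by positivity)
  unfold propagatorDensity
  positivity

/-- A bound on the density from bounds on its ingredients. -/
theorem propagatorDensity_le {D : ℕ} {Ω m t κ s a b : ℝ} (hb : 0 < b)
    (hexp : exp (-(m ^ 2 * t)) ≤ a) (hsinh : b ≤ sinh (2 * Ω * t))
    (hcoth : κ * s ^ 2 ≤ 1 / (4 * Ω) * (cosh (Ω * t) / sinh (Ω * t)))
    (htanh : κ * (s ^ 2)⁻¹ ≤ 1 / (4 * Ω) * tanh (Ω * t)) (p q : MomentumSpace D) :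
    propagatorDensity Ω m t p q ≤ a / b ^ ((D : ℝ) / 2) * scaleGaussian κ s p q := by
  have hs : 0 < sinh (2 * Ω * t) := hb.trans_le hsinh
  unfold propagatorDensity scaleGaussian
  rw [← exp_add]
  have ha : 0 ≤ a := (exp_pos _).le.trans hexp
  gcongr
  nlinarith [mul_le_mul_of_nonneg_right hcoth (sq_nonneg ‖p + q‖),
    mul_le_mul_of_nonneg_right htanh (sq_nonneg ‖p - q‖)]

theorem rpow_half_inv_sq {s : ℝ} (hs : 0 < s) (D : ℕ) :
    ((s ^ 2)⁻¹) ^ ((D : ℝ) / 2) = (s ^ D)⁻¹ := by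
  rw [inv_rpow (by positivity), ← rpow_natCast s 2, ← rpow_mul hs.le, ← rpow_natCast s D]
  congr 2
  push_cast
  ring

/-- On each slice the density is bounded by a Gaussian in the momenta times a function of time whose
integral is of the order of the length `s⁻²` of the slice times the value `s ^ D` of the
prefactor, where `s = M ^ i`. -/
theorem exists_propagatorDensity_le (D : ℕ) {Ω m M : ℝ} (hΩ : 0 < Ω) (hm : D = 0 → m ≠ 0)
    (hM : 1 < M) : ∃ κ K : ℝ, 0 < κ ∧ 0 < K ∧ ∀ i : ℕ, ∃ w : ℝ → ℝ,
      IntegrableOn w (sliceTimes M i) ∧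
      ∫ t in sliceTimes M i, w t ≤ K * (((M ^ i) ^ 2)⁻¹ * (M ^ i) ^ D) ∧
      ∀ t ∈ sliceTimes M i, ∀ p q : MomentumSpace D,
        propagatorDensity Ω m t p q ≤ w t * scaleGaussian κ (M ^ i) p q := by
  set τ : ℝ := (1 - exp (-(2 * Ω))) / 2 with hτ
  have hτ0 : 0 < τ := by
    have : exp (-(2 * Ω)) < 1 := by
      rw [← exp_zero]
      exact exp_lt_exp.2 (by linarith)
    rw [hτ]; linarith
  have hM0 : 0 < M := by linarith
  set κ : ℝ := min (min (1 / (4 * Ω)) (1 / (4 * Ω) * τ))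
    (min (1 / (4 * Ω) * (1 / (Ω * exp Ω * M ^ 2))) (1 / (4 * Ω) * (Ω / exp Ω))) with hκ
  have hκ0 : 0 < κ := by
    rw [hκ]
    refine lt_min (lt_min ?_ ?_) (lt_min ?_ ?_) <;> positivity
  have hκ1 : κ ≤ 1 / (4 * Ω) := (min_le_left _ _).trans (min_le_left _ _)
  have hκ2 : κ ≤ 1 / (4 * Ω) * τ := (min_le_left _ _).trans (min_le_right _ _)
  have hκ3 : κ ≤ 1 / (4 * Ω) * (1 / (Ω * exp Ω * M ^ 2)) :=
    (min_le_right _ _).trans (min_le_left _ _)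
  have hκ4 : κ ≤ 1 / (4 * Ω) * (Ω / exp Ω) := (min_le_right _ _).trans (min_le_right _ _)
  have hr : 0 < m ^ 2 + Ω * D := by
    rcases Nat.eq_zero_or_pos D with h | h
    · have := hm h; positivity
    · positivity
  set K₁ : ℝ := (τ ^ ((D : ℝ) / 2))⁻¹ *
    ∫ t in Ioi (1 : ℝ), exp (-(m ^ 2 + Ω * D) * t) with hK₁
  set K₂ : ℝ := M ^ 2 / (2 * Ω) ^ ((D : ℝ) / 2) with hK₂
  have hint : IntegrableOn (fun t => exp (-(m ^ 2 + Ω * D) * t)) (Ioi (1 : ℝ)) :=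
    integrableOn_exp_mul_Ioi (by linarith) 1
  have hK₁0 : 0 ≤ K₁ := by positivity
  have hK₂0 : 0 < K₂ := by positivity
  refine ⟨κ, K₁ + K₂, hκ0, by positivity, fun i => ?_⟩
  rcases i with _ | i
  · refine ⟨fun t => (τ ^ ((D : ℝ) / 2))⁻¹ * exp (-(m ^ 2 + Ω * D) * t),
      hint.const_mul _, ?_, fun t ht p q => ?_⟩
    · rw [integral_const_mul]
      simp only [sliceTimes, pow_zero, one_pow, inv_one, mul_one]
      linarith
    · have ht : 1 < t := ht
      have hΩt : Ω ≤ Ω * t := by nlinarith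
      have hsinh0 : 0 < sinh (Ω * t) := sinh_pos_iff.2 (by positivity)
      have hsc : sinh (Ω * t) < cosh (Ω * t) := sinh_lt_cosh _
      refine (propagatorDensity_le (a := exp (-(m ^ 2 * t)))
        (b := τ * exp (2 * Ω * t)) (κ := κ) (s := M ^ 0) (by positivity) le_rfl
        (mul_exp_le_sinh (by nlinarith)) ?_ ?_ p q).trans_eq ?_
      · rw [pow_zero, one_pow, mul_one]
        refine hκ1.trans (le_mul_of_one_le_right (by positivity) ?_)
        rw [one_le_div hsinh0]
        exact hsc.le
      · rw [pow_zero, one_pow, inv_one, mul_one]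
        refine hκ2.trans (mul_le_mul_of_nonneg_left ?_ (by positivity))
        rw [tanh_eq_sinh_div_cosh, le_div_iff₀ (cosh_pos _)]
        refine le_trans ?_ (mul_exp_le_sinh hΩt)
        exact mul_le_mul_of_nonneg_left (cosh_le_exp_of_nonneg (by positivity)) hτ0.le
      · congr 1
        rw [mul_rpow hτ0.le (exp_pos _).le, ← exp_mul, ← div_div, div_eq_mul_inv, div_eq_mul_inv,
          ← exp_neg, mul_comm (exp _), mul_assoc, ← exp_add]
        congr 2
        ring
  · have hs : 0 < M ^ (i + 1) := by positivity
    set s : ℝ := M ^ (i + 1) with hs_def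
    have hslice : sliceTimes M (i + 1) = Ioc ((s ^ 2)⁻¹) (M ^ 2 * (s ^ 2)⁻¹) := by
      rw [sliceTimes, hs_def, ← pow_mul, mul_comm (i + 1) 2]
      congr 1
      rw [mul_add, pow_add, mul_one]
      field_simp
    have hle1 : M ^ 2 * (s ^ 2)⁻¹ ≤ 1 := by
      rw [← div_eq_mul_inv, div_le_one (by positivity)]
      refine pow_le_pow_left₀ hM0.le ?_ 2
      rw [hs_def, pow_succ]
      nlinarith [one_le_pow₀ (n := i) hM.le]
    refine ⟨fun _ => 1 / (2 * Ω * (s ^ 2)⁻¹) ^ ((D : ℝ) / 2), ?_, ?_, fun t ht p q => ?_⟩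
    · rw [hslice]
      exact integrableOn_const (by simp)
    · rw [hslice, setIntegral_const, measureReal_def, Real.volume_Ioc, ENNReal.toReal_ofReal
        (by rw [sub_nonneg]; exact le_mul_of_one_le_left (by positivity) (one_le_pow₀ hM.le)),
        mul_rpow (by positivity) (by positivity), rpow_half_inv_sq hs, smul_eq_mul]
      have : (M ^ 2 * (s ^ 2)⁻¹ - (s ^ 2)⁻¹) * (1 / ((2 * Ω) ^ ((D : ℝ) / 2) * (s ^ D)⁻¹)) ≤
          (M ^ 2 * (s ^ 2)⁻¹) * (1 / ((2 * Ω) ^ ((D : ℝ) / 2) * (s ^ D)⁻¹)) := by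
        gcongr
        linarith [show 0 < (s ^ 2)⁻¹ by positivity]
      refine this.trans ?_
      have : M ^ 2 * (s ^ 2)⁻¹ * (1 / ((2 * Ω) ^ ((D : ℝ) / 2) * (s ^ D)⁻¹)) =
          K₂ * ((s ^ 2)⁻¹ * s ^ D) := by
        rw [hK₂]
        have : (2 * Ω) ^ ((D : ℝ) / 2) ≠ 0 := by positivity
        field_simp
      rw [this]
      gcongr
      linarith
    · rw [hslice] at ht
      have ht0 : 0 < t := lt_trans (by positivity) ht.1
      have ht1 : t ≤ 1 := ht.2.trans hle1
      have hΩt : Ω * t ≤ Ω := by nlinarith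
      have hsinh0 : 0 < sinh (Ω * t) := sinh_pos_iff.2 (by positivity)
      refine propagatorDensity_le (by positivity) (exp_le_one_iff.2 ?_) ?_ ?_ ?_ p q
      · have : 0 ≤ m ^ 2 * t := by positivity
        linarith
      · refine le_trans ?_ (self_le_sinh_iff.2 (by positivity))
        exact mul_le_mul_of_nonneg_left ht.1.le (by positivity)
      · have hup : sinh (Ω * t) ≤ Ω * exp Ω * M ^ 2 * (s ^ 2)⁻¹ := by
          calc sinh (Ω * t) ≤ Ω * t * exp (Ω * t) := sinh_le_mul_exp _
            _ ≤ Ω * (M ^ 2 * (s ^ 2)⁻¹) * exp Ω := by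
              gcongr
              exact ht.2
            _ = _ := by ring
        calc κ * s ^ 2 ≤ 1 / (4 * Ω) * (1 / (Ω * exp Ω * M ^ 2)) * s ^ 2 := by gcongr
          _ = 1 / (4 * Ω) * (1 / (Ω * exp Ω * M ^ 2 * (s ^ 2)⁻¹)) := by field_simp
          _ ≤ 1 / (4 * Ω) * (cosh (Ω * t) / sinh (Ω * t)) := by
            gcongr
            exact one_le_cosh _
      · calc κ * (s ^ 2)⁻¹ ≤ 1 / (4 * Ω) * (Ω / exp Ω) * (s ^ 2)⁻¹ := by gcongr
          _ = 1 / (4 * Ω) * (Ω * (s ^ 2)⁻¹ / exp Ω) := by ring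
          _ ≤ 1 / (4 * Ω) * tanh (Ω * t) := by
            rw [tanh_eq_sinh_div_cosh]
            refine mul_le_mul_of_nonneg_left (div_le_div₀ (sinh_pos_iff.2 (by positivity)).le ?_
              (cosh_pos _) ?_) (by positivity)
            · refine le_trans ?_ (self_le_sinh_iff.2 (by positivity))
              exact mul_le_mul_of_nonneg_left ht.1.le hΩ.le
            · exact (cosh_le_exp_of_nonneg (by positivity)).trans (exp_le_exp.2 hΩt)

theorem measurable_propagatorDensity (D : ℕ) (Ω m : ℝ) :
    Measurable fun x : (MomentumSpace D × MomentumSpace D) × ℝ =>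
      propagatorDensity Ω m x.2 x.1.1 x.1.2 := by
  unfold propagatorDensity
  simp only [tanh_eq_sinh_div_cosh]
  fun_prop

theorem measurable_propagatorOn (D : ℕ) (Ω m : ℝ) (T : Set ℝ) :
    Measurable fun x : MomentumSpace D × MomentumSpace D => propagatorOn Ω m T x.1 x.2 := by
  unfold propagatorOn
  exact ((measurable_propagatorDensity D Ω m).stronglyMeasurable.integral_prod_right
    (ν := volume.restrict T)).measurable.const_mul _

theorem integrableOn_propagatorDensity_sliceTimes {D : ℕ} {Ω m M : ℝ} (hΩ : 0 < Ω)
    (hm : D = 0 → m ≠ 0) (hM : 1 < M) (i : ℕ) (p q : MomentumSpace D) :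
    IntegrableOn (fun t => propagatorDensity Ω m t p q) (sliceTimes M i) := by
  obtain ⟨κ, K, -, -, h⟩ := exists_propagatorDensity_le D hΩ hm hM
  obtain ⟨w, hw, -, hle⟩ := h i
  refine Integrable.mono' (hw.mul_const (scaleGaussian κ (M ^ i) p q))
    (((measurable_propagatorDensity D Ω m).comp
      (measurable_prodMk_left (x := (p, q)))).aestronglyMeasurable) ?_
  refine (ae_restrict_mem (measurableSet_sliceTimes M i)).mono fun t ht => ?_
  rw [norm_of_nonneg (propagatorDensity_nonneg hΩ (sliceTimes_subset_Ioi hM i ht) p q)]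
  exact hle t ht p q

theorem propagatorSlice_nonneg {D : ℕ} {Ω m M : ℝ} (hΩ : 0 < Ω) (hM : 1 < M) (i : ℕ)
    (p q : MomentumSpace D) : 0 ≤ propagatorSlice Ω m M i p q :=
  mul_nonneg (by positivity) (setIntegral_nonneg (measurableSet_sliceTimes M i)
    fun _ ht => propagatorDensity_nonneg hΩ (sliceTimes_subset_Ioi hM i ht) p q)

/-- The slice of scale `s = M ^ i` is at most of the order of `s⁻² s ^ D` times a Gaussian
localizing `p + q` in a ball of radius `1 / s` and `p - q` in a ball of radius `s`. -/
theorem exists_propagatorSlice_le (D : ℕ) {Ω m M : ℝ} (hΩ : 0 < Ω) (hm : D = 0 → m ≠ 0)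
    (hM : 1 < M) : ∃ κ K : ℝ, 0 < κ ∧ 0 < K ∧ ∀ (i : ℕ) (p q : MomentumSpace D),
      propagatorSlice Ω m M i p q ≤
        K * (((M ^ i) ^ 2)⁻¹ * (M ^ i) ^ D) * scaleGaussian κ (M ^ i) p q := by
  obtain ⟨κ, K, hκ, hK, h⟩ := exists_propagatorDensity_le D hΩ hm hM
  have hc : 0 < (2 * π / Ω) ^ ((D : ℝ) / 2) := by positivity
  refine ⟨κ, (2 * π / Ω) ^ ((D : ℝ) / 2) * K, hκ, by positivity, fun i p q => ?_⟩
  obtain ⟨w, hw, hwle, hle⟩ := h i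
  rw [propagatorSlice, propagatorOn, mul_assoc (_ ^ _) K, mul_assoc]
  refine mul_le_mul_of_nonneg_left ?_ hc.le
  calc ∫ t in sliceTimes M i, propagatorDensity Ω m t p q
      ≤ ∫ t in sliceTimes M i, w t * scaleGaussian κ (M ^ i) p q :=
        setIntegral_mono_on (integrableOn_propagatorDensity_sliceTimes hΩ hm hM i p q)
          (hw.mul_const _) (measurableSet_sliceTimes M i) fun t ht => hle t ht p q
    _ = (∫ t in sliceTimes M i, w t) * scaleGaussian κ (M ^ i) p q := integral_mul_const _ _
    _ ≤ _ := mul_le_mul_of_nonneg_right hwle (by unfold scaleGaussian; positivity)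

/-- The slices up to `ρ` add up to the propagator with cutoff `ρ`; integrability in time matters
here, as the integrals would not be additive without it. -/
theorem propagatorCutoff_eq_sum {D : ℕ} {Ω m M : ℝ} (hΩ : 0 < Ω) (hm : D = 0 → m ≠ 0)
    (hM : 1 < M) (ρ : ℕ) (p q : MomentumSpace D) :
    propagatorCutoff Ω m M ρ p q = ∑ i ∈ Finset.range (ρ + 1), propagatorSlice Ω m M i p q := by
  have hint := integrableOn_propagatorDensity_sliceTimes (D := D) hΩ hm hM
  simp only [propagatorCutoff, propagatorSlice, propagatorOn, ← Finset.mul_sum]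
  congr 1
  suffices h : IntegrableOn (fun t => propagatorDensity Ω m t p q) (Ioi ((M ^ (2 * ρ))⁻¹)) ∧
      ∫ t in Ioi ((M ^ (2 * ρ))⁻¹), propagatorDensity Ω m t p q =
        ∑ i ∈ Finset.range (ρ + 1), ∫ t in sliceTimes M i, propagatorDensity Ω m t p q from h.2
  induction ρ with
  | zero =>
    have h0 : Ioi ((M ^ (2 * 0))⁻¹) = sliceTimes M 0 := by simp [sliceTimes]
    rw [h0]
    exact ⟨hint 0 p q, by simp⟩
  | succ ρ ih =>
    have hle : (M ^ (2 * (ρ + 1)))⁻¹ ≤ (M ^ (2 * ρ))⁻¹ :=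
      inv_anti₀ (by positivity) (pow_le_pow_right₀ hM.le (by omega))
    rw [← Ioc_union_Ioi_eq_Ioi hle]
    refine ⟨(hint (ρ + 1) p q).union ih.1, ?_⟩
    rw [Finset.sum_range_succ _ (ρ + 1), ← ih.2]
    refine Eq.trans ?_ (add_comm _ _)
    exact setIntegral_union (Set.disjoint_left.2 fun t ht ht' => ht.2.not_gt ht') measurableSet_Ioi
      (hint (ρ + 1) p q) ih.1

end Propagator

/-! ### Momentum integrals in adapted coordinates -/

section Integrals

open scoped ENNReal NNReal

theorem lintegral_fintype_prod {ι E : Type*} [Fintype ι] [MeasureSpace E]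
    [SigmaFinite (volume : Measure E)] {f : ι → E → ℝ≥0∞} (hf : ∀ i, Measurable (f i)) :
    ∫⁻ x : ι → E, ∏ i, f i (x i) = ∏ i, ∫⁻ y, f i y := by
  classical
  have key : ∀ (s : Finset ι) (x : ι → E),
      (∫⋯∫⁻_s, (fun x => ∏ i ∈ s, f i (x i)) ∂(fun _ => volume)) x = ∏ i ∈ s, ∫⁻ y, f i y := by
    intro s
    induction s using Finset.induction_on with
    | empty => intro x; simp
    | insert i s hi ih =>
      intro x
      have hmeas : ∀ t : Finset ι, Measurable fun x : ι → E => ∏ j ∈ t, f j (x j) := fun t =>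
        Finset.measurable_fun_prod _ fun j _ => (hf j).comp (measurable_pi_apply j)
      rw [lmarginal_insert _ (hmeas _) hi, Finset.prod_insert hi, ← lintegral_mul_const _ (hf i)]
      refine lintegral_congr fun y => ?_
      rw [← ih (Function.update x i y), lmarginal, lmarginal, ← lintegral_const_mul]
      · refine lintegral_congr fun z => ?_
        rw [Finset.prod_insert hi]
        congr 2
        rw [Function.updateFinset_def]
        simp [hi]
      · exact (hmeas s).comp measurable_updateFinset
  have h := lmarginal_univ (μ := fun _ : ι => (volume : Measure E))
    (f := fun x : ι → E => ∏ i, f i (x i))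
  by_cases hne : Nonempty (ι → E)
  · obtain ⟨x⟩ := hne
    rw [← key Finset.univ x, h]
    rfl
  · rw [not_nonempty_iff] at hne
    obtain ⟨i, hi⟩ : ∃ i : ι, IsEmpty E := by
      by_contra! h'
      exact hne.elim fun i => (h' i).some
    rw [lintegral_of_isEmpty, Finset.prod_eq_zero (Finset.mem_univ i)]
    exact lintegral_of_isEmpty _ _

/-- Products of σ-finite Haar measures are such measures; instance search does not find this for
`volume` on nested products. -/
theorem sigmaFinite_isAddHaarMeasure_volume_pi {ι E : Type*} [Fintype ι] [AddGroup E]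
    [TopologicalSpace E] [IsTopologicalAddGroup E] [MeasureSpace E] [BorelSpace E] [SecondCountableTopology E]
    [SigmaFinite (volume : Measure E)] [(volume : Measure E).IsAddHaarMeasure] :
    SigmaFinite (volume : Measure (ι → E)) ∧ (volume : Measure (ι → E)).IsAddHaarMeasure :=
  ⟨inferInstanceAs (SigmaFinite (Measure.pi fun _ : ι => (volume : Measure E))),
    inferInstanceAs (Measure.pi fun _ : ι => (volume : Measure E)).IsAddHaarMeasure⟩

theorem sigmaFinite_isAddHaarMeasure_volume_prod {V W : Type*} [AddGroup V] [TopologicalSpace V]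
    [IsTopologicalAddGroup V] [MeasureSpace V] [BorelSpace V] [SecondCountableTopology V]
    [SigmaFinite (volume : Measure V)] [(volume : Measure V).IsAddHaarMeasure] [AddGroup W]
    [TopologicalSpace W] [IsTopologicalAddGroup W] [MeasureSpace W] [BorelSpace W]
    [SecondCountableTopology W] [SigmaFinite (volume : Measure W)]
    [(volume : Measure W).IsAddHaarMeasure] :
    SigmaFinite (volume : Measure (V × W)) ∧ (volume : Measure (V × W)).IsAddHaarMeasure :=
  ⟨inferInstanceAs (SigmaFinite ((volume : Measure V).prod (volume : Measure W))),
    inferInstanceAs ((volume : Measure V).prod (volume : Measure W)).IsAddHaarMeasure⟩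

/-- A linear bijection of finite-dimensional spaces multiplies Lebesgue integrals by a constant. -/
theorem exists_lintegral_comp_linearMap {V W : Type*} [NormedAddCommGroup V] [NormedSpace ℝ V]
    [FiniteDimensional ℝ V] [MeasurableSpace V] [BorelSpace V] [NormedAddCommGroup W]
    [NormedSpace ℝ W] [FiniteDimensional ℝ W] [MeasurableSpace W] [BorelSpace W]
    (μ : Measure V) [μ.IsAddHaarMeasure] (ν : Measure W) [ν.IsAddHaarMeasure]
    (A : V →ₗ[ℝ] W) (hA : Function.Injective A)
    (hdim : Module.finrank ℝ V = Module.finrank ℝ W) :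
    ∃ c : ℝ≥0, ∀ f : W → ℝ≥0∞, Measurable f → ∫⁻ v, f (A v) ∂μ = c * ∫⁻ w, f w ∂ν := by
  let L : V ≃L[ℝ] W := (LinearMap.linearEquivOfInjective A hA hdim).toContinuousLinearEquiv
  have : (μ.map L).IsAddHaarMeasure := L.isAddHaarMeasure_map μ
  refine ⟨(μ.map L).addHaarScalarFactor ν, fun f hf => ?_⟩
  have h : ∫⁻ v, f (A v) ∂μ = ∫⁻ w, f w ∂(μ.map L) :=
    (lintegral_map hf L.continuous.measurable).symm
  have h' := congrArg (fun ν' => ∫⁻ w, f w ∂ν') (Measure.isAddLeftInvariant_eq_smul (μ.map L) ν)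
  simp only [lintegral_smul_measure] at h'
  exact h.trans h'

/-- The Cauchy-Schwarz inequality for a convolution. -/
theorem lintegral_enorm_mul_enorm_sub_le {E : Type*} [NormedAddCommGroup E] [MeasurableSpace E]
    [BorelSpace E] (ν : Measure E) [ν.IsAddLeftInvariant] [ν.IsNegInvariant] {f g : E → ℂ}
    (hf : Measurable f) (hg : Measurable g) (w : E) :
    ∫⁻ k, ‖f k‖ₑ * ‖g (w - k)‖ₑ ∂ν ≤ eLpNorm f 2 ν * eLpNorm g 2 ν := by
  have hmp : MeasurePreserving (fun k => w - k) ν ν := Measure.measurePreserving_sub_left ν w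
  rw [← eLpNorm_comp_measurePreserving hg.aestronglyMeasurable hmp,
    eLpNorm_eq_lintegral_rpow_enorm_toReal two_ne_zero ENNReal.ofNat_ne_top,
    eLpNorm_eq_lintegral_rpow_enorm_toReal two_ne_zero ENNReal.ofNat_ne_top]
  exact ENNReal.lintegral_mul_le_Lp_mul_Lq ν (by simpa using Real.HolderConjugate.two_two)
    hf.enorm.aemeasurable (hg.comp hmp.measurable).enorm.aemeasurable

/-- An integral over four factors, with a uniform bound on the inner integral over the first one. -/
theorem lintegral_prod_mul_le_of_forall_le {E X Y Z : Type*} [MeasureSpace E] [MeasureSpace X]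
    [MeasureSpace Y] [MeasureSpace Z] [SigmaFinite (volume : Measure E)]
    [SigmaFinite (volume : Measure X)] [SigmaFinite (volume : Measure Y)]
    [SigmaFinite (volume : Measure Z)] {k : E → X → Y → Z → ℝ≥0∞} {u : X → ℝ≥0∞} {v : Y → ℝ≥0∞}
    {w : Z → ℝ≥0∞} {C : ℝ≥0∞} (hk : Measurable fun z : E × X × Y × Z => k z.1 z.2.1 z.2.2.1 z.2.2.2)
    (hu : Measurable u) (hv : Measurable v) (hw : Measurable w)
    (hC : ∀ x y z, ∫⁻ e, k e x y z ≤ C) :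
    ∫⁻ z : E × X × Y × Z, k z.1 z.2.1 z.2.2.1 z.2.2.2 * (u z.2.1 * (v z.2.2.1 * w z.2.2.2)) ≤
      C * ((∫⁻ x, u x) * ((∫⁻ y, v y) * ∫⁻ z, w z)) := by
  have hvw : Measurable fun y : Y × Z => v y.1 * w y.2 := by fun_prop
  have huvw : Measurable fun y : X × Y × Z => u y.1 * (v y.2.1 * w y.2.2) := by fun_prop
  calc ∫⁻ z : E × X × Y × Z, k z.1 z.2.1 z.2.2.1 z.2.2.2 * (u z.2.1 * (v z.2.2.1 * w z.2.2.2))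
      = ∫⁻ y : X × Y × Z, ∫⁻ e, k e y.1 y.2.1 y.2.2 * (u y.1 * (v y.2.1 * w y.2.2)) :=
        lintegral_prod_symm' (μ := (volume : Measure E)) (ν := (volume : Measure (X × Y × Z))) _
          (by fun_prop)
    _ ≤ ∫⁻ y : X × Y × Z, C * (u y.1 * (v y.2.1 * w y.2.2)) := by
        refine lintegral_mono fun y => ?_
        have hky : Measurable fun e => k e y.1 y.2.1 y.2.2 := hk.comp measurable_prodMk_right
        rw [lintegral_mul_const _ hky]
        gcongr
        exact hC _ _ _
    _ = C * ∫⁻ y : X × Y × Z, u y.1 * (v y.2.1 * w y.2.2) := lintegral_const_mul _ huvw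
    _ = C * ((∫⁻ x, u x) * ∫⁻ y : Y × Z, v y.1 * w y.2) := by
        congr 1
        exact lintegral_prod_mul (ν := (volume : Measure (Y × Z))) hu.aemeasurable hvw.aemeasurable
    _ = _ := by
        congr 2
        exact lintegral_prod_mul (ν := (volume : Measure Z)) hv.aemeasurable hw.aemeasurable

/-- The last two indices of `Fin N` split off from a product. -/
@[to_additive]
theorem prod_fin_split_last_two {α : Type*} [CommMonoid α] {N : ℕ} (hN : 2 ≤ N) (f : Fin N → α) :
    ∏ e, f e = f ⟨N - 2, by omega⟩ * f ⟨N - 1, by omega⟩ *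
      ∏ e : {e : Fin N // (e : ℕ) + 2 < N}, f e := by
  classical
  rw [← Finset.prod_filter_mul_prod_filter_not Finset.univ (fun e : Fin N => (e : ℕ) + 2 < N),
    mul_comm]
  congr 1
  · have : (Finset.univ.filter fun e : Fin N => ¬ (e : ℕ) + 2 < N) =
        {⟨N - 2, by omega⟩, ⟨N - 1, by omega⟩} := by
      ext e
      simp only [Finset.mem_filter, Finset.mem_univ, true_and, Finset.mem_insert,
        Finset.mem_singleton, Fin.ext_iff]
      omega
    rw [this, Finset.prod_pair (by simp only [ne_eq, Fin.ext_iff]; omega)]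
  · exact Finset.prod_subtype _ (by simp) f

end Integrals

namespace Phi4Graph

open scoped ENNReal NNReal

variable {D : ℕ} (G : Phi4Graph)

theorem slotMomentum_add (P Q : Fin G.numVert → Fin 3 → MomentumSpace D)
    (s : Fin G.numVert × Fin 4) :
    G.slotMomentum (P + Q) s = G.slotMomentum P s + G.slotMomentum Q s := by
  obtain ⟨v, a⟩ := s
  refine Fin.cases ?_ (fun j => ?_) a
  · simp [slotMomentum, Finset.sum_add_distrib, add_comm]
  · simp [slotMomentum]

theorem slotMomentum_smul (c : ℝ) (P : Fin G.numVert → Fin 3 → MomentumSpace D)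
    (s : Fin G.numVert × Fin 4) : G.slotMomentum (c • P) s = c • G.slotMomentum P s := by
  obtain ⟨v, a⟩ := s
  refine Fin.cases ?_ (fun j => ?_) a
  · simp [slotMomentum, ← Finset.smul_sum]
  · simp [slotMomentum]

theorem measurable_slotMomentum (s : Fin G.numVert × Fin 4) :
    Measurable fun P : Fin G.numVert → Fin 3 → MomentumSpace D => G.slotMomentum P s := by
  obtain ⟨v, a⟩ := s
  refine Fin.cases ?_ (fun j => ?_) a
  · simp only [slotMomentum, Matrix.cons_val_zero]
    fun_prop
  · simp only [slotMomentum, Matrix.cons_val_succ]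
    fun_prop

theorem eq_zero_of_slotMomentum_eq_zero {P : Fin G.numVert → Fin 3 → MomentumSpace D}
    (h : ∀ s, G.slotMomentum P s = 0) : P = 0 := by
  ext1 v
  ext1 j
  simpa [slotMomentum] using h (v, j.succ)

/-- Momentum conservation at the vertices, tested against the weights `w` of the vertices. -/
theorem sum_smul_lineMomentum_add (P : Fin G.numVert → Fin 3 → MomentumSpace D)
    (w : Fin G.numVert → ℝ) :
    ∑ l, (w (G.lineEnd l false) • G.lineMomentum P l false +
        w (G.lineEnd l true) • G.lineMomentum P l true) +
      ∑ e, w (G.hook (Sum.inr e)).1 • G.legMomentum P e = 0 := by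
  have h : ∑ s : Fin G.numVert × Fin 4, w s.1 • G.slotMomentum P s = 0 := by
    rw [Fintype.sum_prod_type]
    refine Finset.sum_eq_zero fun v _ => ?_
    change ∑ a, w v • G.slotMomentum P (v, a) = 0
    rw [← Finset.smul_sum, Fin.sum_univ_succ]
    simp [slotMomentum]
  rw [← Equiv.sum_comp G.hook, Fintype.sum_sum_type, Fintype.sum_prod_type] at h
  simp only [Fintype.sum_bool] at h
  rw [← h]
  congr 1
  exact Finset.sum_congr rfl fun l _ => add_comm _ _

/-- The number of external legs is even, so a graph with one leg has a second one. -/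
theorem two_le_numLegs (hlegs : 0 < G.numLegs) : 2 ≤ G.numLegs := by
  have := G.two_mul_numLines_add_numLegs
  omega

/-- The last external momentum is fixed by the others and by the total momenta of the lines, which
are not conserved along the lines. -/
theorem legMomentum_last (hN : 2 ≤ G.numLegs) (P : Fin G.numVert → Fin 3 → MomentumSpace D) :
    G.legMomentum P ⟨G.numLegs - 1, by omega⟩ =
      -(∑ l, (G.lineMomentum P l false + G.lineMomentum P l true) +
        ∑ e : {e : Fin G.numLegs // (e : ℕ) + 2 < G.numLegs}, G.legMomentum P e) -
      G.legMomentum P ⟨G.numLegs - 2, by omega⟩ := by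
  have h := G.sum_smul_lineMomentum_add P 1
  simp only [Pi.one_apply, one_smul] at h
  rw [sum_fin_split_last_two hN] at h
  rw [← sub_eq_zero, ← h]
  abel

/-- The coordinates adapted to a set `B` of loop lines: all the external momenta but the last one,
the total momenta `p + q` of the lines, and the relative momenta `p - q` of the lines of `B`. -/
noncomputable def adaptedCoordinates (B : Finset (Fin G.numLines)) (hN : 2 ≤ G.numLegs) :
    (Fin G.numVert → Fin 3 → MomentumSpace D) →ₗ[ℝ]
      MomentumSpace D × ({e : Fin G.numLegs // (e : ℕ) + 2 < G.numLegs} → MomentumSpace D) ×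
        (Fin G.numLines → MomentumSpace D) × (B → MomentumSpace D) where
  toFun P := (G.legMomentum P ⟨G.numLegs - 2, by omega⟩, fun e => G.legMomentum P e,
    fun l => G.lineMomentum P l false + G.lineMomentum P l true,
    fun l => G.lineMomentum P l false - G.lineMomentum P l true)
  map_add' P Q := by
    simp only [legMomentum, lineMomentum, slotMomentum_add, Prod.mk_add_mk, Prod.mk.injEq, true_and]
    refine ⟨rfl, ?_, ?_⟩
    · ext1 l
      simp only [Pi.add_apply]
      abel
    · ext1 l
      simp only [Pi.add_apply]
      abel
  map_smul' c P := by
    simp only [legMomentum, lineMomentum, slotMomentum_smul, ← smul_add, ← smul_sub]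
    rfl

/-- The adapted coordinates determine all momenta: when they vanish, so does the last external
momentum by overall conservation, and then the momenta of the lines are loop momenta without
component on `B`. -/
theorem adaptedCoordinates_injective {B : Finset (Fin G.numLines)} (hB : G.IsLoopSet B)
    (hN : 2 ≤ G.numLegs) : Function.Injective (G.adaptedCoordinates (D := D) B hN) := by
  rw [← LinearMap.ker_eq_bot, LinearMap.ker_eq_bot']
  intro P hP
  simp only [adaptedCoordinates, LinearMap.coe_mk, AddHom.coe_mk, Prod.mk_eq_zero,
    funext_iff, Pi.zero_apply, Subtype.forall] at hP
  obtain ⟨hk, hks, hu, hw⟩ := hP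
  have hleg : ∀ e, G.legMomentum P e = 0 := by
    intro e
    by_cases he : (e : ℕ) + 2 < G.numLegs
    · exact hks e he
    by_cases he' : e = ⟨G.numLegs - 2, by omega⟩
    · rw [he', hk]
    · have : e = ⟨G.numLegs - 1, by omega⟩ := by
        rw [Fin.ext_iff] at he' ⊢
        simp only at he' ⊢
        omega
      rw [this, G.legMomentum_last hN, hk, Finset.sum_eq_zero fun l _ => hu l,
        Finset.sum_eq_zero fun e _ => hks e.1 e.2]
      simp
  have hneg : ∀ l, G.lineMomentum P l true = -G.lineMomentum P l false := fun l =>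
    eq_neg_of_add_eq_zero_right (hu l)
  have hline : ∀ l, G.lineMomentum P l false = 0 := by
    suffices h : ∀ d : Fin D, (fun l => G.lineMomentum P l false d) = 0 by
      intro l
      ext d
      exact congrFun (h d) l
    intro d
    refine hB.2 _ ⟨fun l hl => absurd (Finset.mem_univ l) hl, fun v => ?_⟩ fun l hl => ?_
    · have h := G.sum_smul_lineMomentum_add P fun v' => if v' = v then 1 else 0
      simp only [hleg, smul_zero, Finset.sum_const_zero, add_zero, hneg] at h
      have h' := congrArg (fun x : MomentumSpace D => x d) h
      simp only [PiLp.zero_apply] at h'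
      refine Eq.trans ?_ h'
      rw [WithLp.ofLp_sum, Finset.sum_apply]
      refine Finset.sum_congr rfl fun l _ => ?_
      simp only [PiLp.add_apply, PiLp.smul_apply, PiLp.neg_apply, smul_eq_mul]
      ring
    · have h := hw l hl
      rw [hneg, sub_neg_eq_add, ← two_smul ℝ, smul_eq_zero] at h
      rcases h with h | h
      · norm_num at h
      · rw [h, PiLp.zero_apply]
  refine G.eq_zero_of_slotMomentum_eq_zero fun s => ?_
  obtain ⟨x, rfl⟩ := G.hook.surjective s
  rcases x with ⟨l, b⟩ | e
  · cases b
    · exact hline l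
    · exact (hneg l).trans (by rw [hline, neg_zero])
  · exact hleg e

/-- Injectivity bounds the number of momenta by that of the coordinates. Conversely
`4 n = 2 I + N` and `|B| ≤ I - n + 1` give `(N - 1) + I + |B| ≤ 3 n`. -/
theorem finrank_adaptedCoordinates {G : Phi4Graph} (hconn : G.IsConnected)
    {B : Finset (Fin G.numLines)} (hB : G.IsLoopSet B) (hN : 2 ≤ G.numLegs) :
    Module.finrank ℝ (Fin G.numVert → Fin 3 → MomentumSpace D) =
      Module.finrank ℝ (MomentumSpace D ×
        ({e : Fin G.numLegs // (e : ℕ) + 2 < G.numLegs} → MomentumSpace D) ×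
        (Fin G.numLines → MomentumSpace D) × (B → MomentumSpace D)) := by
  have hle := LinearMap.finrank_le_finrank_of_injective
    (G.adaptedCoordinates_injective (D := D) hB hN)
  refine le_antisymm hle ?_
  have hcard : Fintype.card {e : Fin G.numLegs // (e : ℕ) + 2 < G.numLegs} + 2 = G.numLegs := by
    have := sum_fin_split_last_two hN fun _ => 1
    simp only [Finset.sum_const, Finset.card_univ, Fintype.card_fin, smul_eq_mul, mul_one] at this
    omega
  have h1 := G.two_mul_numLines_add_numLegs
  have h2 := finrank_cycleSpace_univ_add_le hconn
  have h3 := hB.1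
  simp only [Module.finrank_prod, Module.finrank_pi_fintype, finrank_euclideanSpace,
    Fintype.card_fin, Finset.sum_const, Finset.card_univ, smul_eq_mul, Fintype.card_coe]
  have : 1 + (Fintype.card {e : Fin G.numLegs // (e : ℕ) + 2 < G.numLegs} +
      (G.numLines + B.card)) ≤ G.numVert * 3 := by omega
  calc _ = (1 + (Fintype.card {e : Fin G.numLegs // (e : ℕ) + 2 < G.numLegs} +
      (G.numLines + B.card))) * D := by ring
    _ ≤ G.numVert * 3 * D := Nat.mul_le_mul_right D this
    _ = _ := by ring

/-- The Jacobian of the adapted coordinates is a constant, whose value plays no role. -/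
theorem exists_lintegral_adaptedCoordinates {G : Phi4Graph} (D : ℕ) (hconn : G.IsConnected)
    {B : Finset (Fin G.numLines)} (hB : G.IsLoopSet B) (hN : 2 ≤ G.numLegs) :
    ∃ c : ℝ≥0, ∀ F : MomentumSpace D ×
        ({e : Fin G.numLegs // (e : ℕ) + 2 < G.numLegs} → MomentumSpace D) ×
        (Fin G.numLines → MomentumSpace D) × (B → MomentumSpace D) → ℝ≥0∞, Measurable F →
      ∫⁻ P : Fin G.numVert → Fin 3 → MomentumSpace D, F (G.adaptedCoordinates B hN P) =
        c * ∫⁻ z, F z := by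
  -- Lebesgue measure on iterated products is σ-finite and a Haar measure.
  obtain ⟨_, _⟩ := sigmaFinite_isAddHaarMeasure_volume_pi (ι := Fin 3) (E := MomentumSpace D)
  obtain ⟨_, _⟩ := sigmaFinite_isAddHaarMeasure_volume_pi (ι := Fin G.numVert)
    (E := Fin 3 → MomentumSpace D)
  obtain ⟨_, _⟩ := sigmaFinite_isAddHaarMeasure_volume_pi
    (ι := {e : Fin G.numLegs // (e : ℕ) + 2 < G.numLegs}) (E := MomentumSpace D)
  obtain ⟨_, _⟩ := sigmaFinite_isAddHaarMeasure_volume_pi (ι := Fin G.numLines)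
    (E := MomentumSpace D)
  obtain ⟨_, _⟩ := sigmaFinite_isAddHaarMeasure_volume_pi (ι := B) (E := MomentumSpace D)
  obtain ⟨_, _⟩ := sigmaFinite_isAddHaarMeasure_volume_prod (V := Fin G.numLines → MomentumSpace D)
    (W := B → MomentumSpace D)
  obtain ⟨_, _⟩ := sigmaFinite_isAddHaarMeasure_volume_prod
    (V := {e : Fin G.numLegs // (e : ℕ) + 2 < G.numLegs} → MomentumSpace D)
    (W := (Fin G.numLines → MomentumSpace D) × (B → MomentumSpace D))
  obtain ⟨_, _⟩ := sigmaFinite_isAddHaarMeasure_volume_prod (V := MomentumSpace D)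
    (W := ({e : Fin G.numLegs // (e : ℕ) + 2 < G.numLegs} → MomentumSpace D) ×
      (Fin G.numLines → MomentumSpace D) × (B → MomentumSpace D))
  exact exists_lintegral_comp_linearMap
    (volume : Measure (Fin G.numVert → Fin 3 → MomentumSpace D)) volume
    (G.adaptedCoordinates B hN) (G.adaptedCoordinates_injective hB hN)
    (finrank_adaptedCoordinates hconn hB hN)

/-- Integration in adapted coordinates: the total momenta of all lines and the relative momenta of
the loop lines are integrated separately, the two last external legs are bounded by the
Cauchy-Schwarz inequality, and the other ones in `L¹`. -/
theorem exists_lintegral_le_of_isLoopSet {G : Phi4Graph} (D : ℕ) (hconn : G.IsConnected)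
    {B : Finset (Fin G.numLines)} (hB : G.IsLoopSet B) (hN : 2 ≤ G.numLegs) :
    ∃ c : ℝ≥0, ∀ (g h : Fin G.numLines → MomentumSpace D → ℝ≥0∞)
      (f : Fin G.numLegs → MomentumSpace D → ℂ), (∀ l, Measurable (g l)) → (∀ l, Measurable (h l)) →
      (∀ e, Measurable (f e)) →
      ∫⁻ P : Fin G.numVert → Fin 3 → MomentumSpace D,
        (∏ l, g l (G.lineMomentum P l false + G.lineMomentum P l true)) *
        (∏ l ∈ B, h l (G.lineMomentum P l false - G.lineMomentum P l true)) *
        ∏ e, ‖f e (G.legMomentum P e)‖ₑ ≤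
      c * ((∏ l, ∫⁻ u, g l u) * (∏ l ∈ B, ∫⁻ w, h l w) *
        ∏ e : Fin G.numLegs, eLpNorm (f e) (if (e : ℕ) + 2 < G.numLegs then 1 else 2) volume) := by
  obtain ⟨c, hc⟩ := exists_lintegral_adaptedCoordinates D hconn hB hN
  refine ⟨c, fun g h f hg hh hf => ?_⟩
  set a : Fin G.numLegs := ⟨G.numLegs - 2, by omega⟩
  set b : Fin G.numLegs := ⟨G.numLegs - 1, by omega⟩
  let F : MomentumSpace D × ({e : Fin G.numLegs // (e : ℕ) + 2 < G.numLegs} → MomentumSpace D) ×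
      (Fin G.numLines → MomentumSpace D) × (B → MomentumSpace D) → ℝ≥0∞ := fun z =>
    (‖f a z.1‖ₑ * ‖f b (-(∑ l, z.2.2.1 l + ∑ e, z.2.1 e) - z.1)‖ₑ) *
      ((∏ e, ‖f e.1 (z.2.1 e)‖ₑ) * ((∏ l, g l (z.2.2.1 l)) * ∏ l, h l.1 (z.2.2.2 l)))
  have hm1 : Measurable fun x : {e : Fin G.numLegs // (e : ℕ) + 2 < G.numLegs} → MomentumSpace D =>
      ∏ e, ‖f e.1 (x e)‖ₑ :=
    Finset.measurable_fun_prod _ fun e _ => by have := hf e.1; fun_prop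
  have hm2 : Measurable fun x : Fin G.numLines → MomentumSpace D => ∏ l, g l (x l) :=
    Finset.measurable_fun_prod _ fun e _ => by have := hg e; fun_prop
  have hm3 : Measurable fun x : B → MomentumSpace D => ∏ l, h l.1 (x l) :=
    Finset.measurable_fun_prod _ fun e _ => by have := hh e.1; fun_prop
  have hk : Measurable fun z : MomentumSpace D ×
      ({e : Fin G.numLegs // (e : ℕ) + 2 < G.numLegs} → MomentumSpace D) ×
      (Fin G.numLines → MomentumSpace D) × (B → MomentumSpace D) =>
      ‖f a z.1‖ₑ * ‖f b (-(∑ l, z.2.2.1 l + ∑ e, z.2.1 e) - z.1)‖ₑ := by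
    have := hf a
    have := hf b
    fun_prop
  have hF : Measurable F :=
    hk.mul ((hm1.comp (by fun_prop)).mul ((hm2.comp (by fun_prop)).mul (hm3.comp (by fun_prop))))
  have hstart : ∀ P : Fin G.numVert → Fin 3 → MomentumSpace D,
      (∏ l, g l (G.lineMomentum P l false + G.lineMomentum P l true)) *
        (∏ l ∈ B, h l (G.lineMomentum P l false - G.lineMomentum P l true)) *
        ∏ e, ‖f e (G.legMomentum P e)‖ₑ = F (G.adaptedCoordinates B hN P) := by
    intro P
    rw [prod_fin_split_last_two hN, G.legMomentum_last hN P, ← Finset.prod_coe_sort B]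
    simp only [F, adaptedCoordinates, LinearMap.coe_mk, AddHom.coe_mk]
    ring
  have hend : ∏ e : Fin G.numLegs,
      eLpNorm (f e) (if (e : ℕ) + 2 < G.numLegs then 1 else 2) volume =
      (eLpNorm (f a) 2 volume * eLpNorm (f b) 2 volume) *
        ∏ e : {e : Fin G.numLegs // (e : ℕ) + 2 < G.numLegs}, ∫⁻ k, ‖f e.1 k‖ₑ := by
    rw [prod_fin_split_last_two hN, if_neg (by simp only; omega), if_neg (by simp only; omega)]
    congr 1
    refine Finset.prod_congr rfl fun e _ => ?_
    rw [if_pos e.2, eLpNorm_one_eq_lintegral_enorm]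
  simp only [hstart]
  rw [hc F hF, hend]
  gcongr
  rw [← lintegral_fintype_prod hg, ← Finset.prod_coe_sort B, ← lintegral_fintype_prod
    fun l : B => hh l.1, mul_comm, ← lintegral_fintype_prod
    fun e : {e : Fin G.numLegs // (e : ℕ) + 2 < G.numLegs} => (hf e.1).enorm, mul_assoc]
  have hC : ∀ (x : {e : Fin G.numLegs // (e : ℕ) + 2 < G.numLegs} → MomentumSpace D)
      (u : Fin G.numLines → MomentumSpace D) (_ : B → MomentumSpace D),
      ∫⁻ k, ‖f a k‖ₑ * ‖f b (-(∑ l, u l + ∑ e, x e) - k)‖ₑ ≤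
        eLpNorm (f a) 2 volume * eLpNorm (f b) 2 volume :=
    fun x u _ => lintegral_enorm_mul_enorm_sub_le volume (hf a) (hf b) _
  have hfin := lintegral_prod_mul_le_of_forall_le
    (E := MomentumSpace D) (X := {e : Fin G.numLegs // (e : ℕ) + 2 < G.numLegs} → MomentumSpace D)
    (Y := Fin G.numLines → MomentumSpace D) (Z := B → MomentumSpace D)
    (k := fun k x u _ => ‖f a k‖ₑ * ‖f b (-(∑ l, u l + ∑ e, x e) - k)‖ₑ) hk hm1 hm2 hm3 hC
  exact hfin

end Phi4Graph

/-! ### Summation over the scale attributions -/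

section Summation

open scoped ENNReal NNReal FourierTransform

/-- `fourierHat` differs from Mathlib's Fourier transform by a dilation by `2π`, so that it
preserves the Schwartz space. -/
theorem exists_schwartzMap_eq_fourierHat {D : ℕ} (f : 𝓢(MomentumSpace D, ℂ)) :
    ∃ g : 𝓢(MomentumSpace D, ℂ), ⇑g = fourierHat f := by
  have hpi : (2 * Real.pi)⁻¹ ≠ 0 := by positivity
  let L : MomentumSpace D ≃L[ℝ] MomentumSpace D :=
    (LinearEquiv.smulOfNeZero ℝ (MomentumSpace D) (2 * Real.pi)⁻¹ hpi).toContinuousLinearEquiv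
  refine ⟨SchwartzMap.compCLMOfContinuousLinearEquiv ℂ L (𝓕 f), ?_⟩
  ext p
  rw [SchwartzMap.compCLMOfContinuousLinearEquiv_apply, Function.comp_apply,
    SchwartzMap.fourier_coe, Real.fourier_eq', fourierHat]
  refine integral_congr_ae (Eventually.of_forall fun x => ?_)
  have hL : L p = (2 * Real.pi)⁻¹ • p := rfl
  have hin : -2 * Real.pi * inner ℝ x (L p) = -inner ℝ p x := by
    rw [hL, inner_smul_right, real_inner_comm]
    field_simp
  simp only [hin, smul_eq_mul]
  rw [mul_comm]
  congr 2
  push_cast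
  ring

theorem measurable_fourierHat {D : ℕ} (f : 𝓢(MomentumSpace D, ℂ)) : Measurable (fourierHat f) := by
  obtain ⟨g, hg⟩ := exists_schwartzMap_eq_fourierHat f
  rw [← hg]
  exact g.continuous.measurable

theorem legNorms_nonneg {D N : ℕ} (φ : Fin N → 𝓢(MomentumSpace D, ℂ)) : 0 ≤ legNorms φ :=
  Finset.prod_nonneg fun _ _ => ENNReal.toReal_nonneg

theorem prod_eLpNorm_fourierHat {D N : ℕ} (φ : Fin N → 𝓢(MomentumSpace D, ℂ)) :
    ∏ e : Fin N, eLpNorm (fourierHat (φ e)) (if (e : ℕ) + 2 < N then 1 else 2) volume =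
      ENNReal.ofReal (legNorms φ) := by
  rw [legNorms, ENNReal.ofReal_prod_of_nonneg fun _ _ => ENNReal.toReal_nonneg]
  refine Finset.prod_congr rfl fun e _ => (ENNReal.ofReal_toReal ?_).symm
  obtain ⟨g, hg⟩ := exists_schwartzMap_eq_fourierHat (φ e)
  rw [← hg]
  exact (g.memLp _ _).eLpNorm_ne_top

theorem lintegral_exp_neg_mul_sq_norm {D : ℕ} {b : ℝ} (hb : 0 < b) :
    ∫⁻ v : MomentumSpace D, ENNReal.ofReal (Real.exp (-b * ‖v‖ ^ 2)) =
      ENNReal.ofReal ((Real.pi / b) ^ ((D : ℝ) / 2)) := by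
  have h := GaussianFourier.integral_rexp_neg_mul_sq_norm (V := MomentumSpace D) hb
  rw [finrank_euclideanSpace, Fintype.card_fin] at h
  have hint : Integrable fun v : MomentumSpace D => Real.exp (-b * ‖v‖ ^ 2) := by
    by_contra hn
    rw [integral_undef hn] at h
    have : 0 < (Real.pi / b) ^ ((D : ℝ) / 2) := by positivity
    exact this.ne h
  rw [← h, ofReal_integral_eq_lintegral_ofReal hint
    (Eventually.of_forall fun _ => (Real.exp_pos _).le)]

theorem enorm_prod_eq {ι : Type*} (s : Finset ι) (f : ι → ℂ) :
    ‖∏ i ∈ s, f i‖ₑ = ∏ i ∈ s, ‖f i‖ₑ := by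
  simp only [enorm, nnnorm_prod, ENNReal.ofNNReal_finsetProd]

namespace Phi4Graph

variable {D : ℕ} {G : Phi4Graph}

theorem measurable_integrand {C : Fin G.numLines → MomentumSpace D → MomentumSpace D → ℝ}
    (hC : ∀ l, Measurable fun x : MomentumSpace D × MomentumSpace D => C l x.1 x.2)
    (φ : Fin G.numLegs → 𝓢(MomentumSpace D, ℂ)) : Measurable (G.integrand C φ) := by
  refine Measurable.mul (Finset.measurable_fun_prod _ fun l _ => ?_)
    (Finset.measurable_fun_prod _ fun e _ => ?_)
  · exact Complex.measurable_ofReal.comp ((hC l).comp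
      ((G.measurable_slotMomentum _).prodMk (G.measurable_slotMomentum _)))
  · exact (measurable_fourierHat (φ e)).comp (G.measurable_slotMomentum _)

/-- The value of an attribution for a given set `B` of loop lines: a line of scale `s = M ^ i`
yields `s⁻²`, and the integration over the relative momentum of a loop line costs `s ^ D`. -/
theorem exists_lintegral_integrand_le_of_isLoopSet (D : ℕ) {Ω m M : ℝ} (hΩ : 0 < Ω)
    (hm : D = 0 → m ≠ 0) (hM : 1 < M) (hconn : G.IsConnected) (hN : 2 ≤ G.numLegs)
    {B : Finset (Fin G.numLines)} (hB : G.IsLoopSet B) :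
    ∃ K : ℝ, 0 ≤ K ∧ ∀ (μ : Fin G.numLines → ℕ) (φ : Fin G.numLegs → 𝓢(MomentumSpace D, ℂ)),
      ∫⁻ P, ‖G.integrand (fun l => propagatorSlice Ω m M (μ l)) φ P‖ₑ ≤
        ENNReal.ofReal (K * ((∏ l, ((M ^ μ l) ^ 2)⁻¹) * ∏ l ∈ B, (M ^ μ l) ^ D) *
          legNorms φ) := by
  obtain ⟨κ, K, hκ, hK, hslice⟩ := exists_propagatorSlice_le D hΩ hm hM
  obtain ⟨c, hc⟩ := exists_lintegral_le_of_isLoopSet D hconn hB hN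
  have hM0 : 0 < M := by linarith
  set A : ℝ := (Real.pi / κ) ^ ((D : ℝ) / 2) with hA
  have hA0 : 0 < A := by positivity
  refine ⟨c * ((K * A) ^ G.numLines * A ^ B.card), by positivity, fun μ φ => ?_⟩
  let s : Fin G.numLines → ℝ := fun l => M ^ μ l
  have hs : ∀ l, 0 < s l := fun l => by positivity
  let g : Fin G.numLines → MomentumSpace D → ℝ≥0∞ := fun l u =>
    ENNReal.ofReal (K * ((s l ^ 2)⁻¹ * s l ^ D)) *
      ENNReal.ofReal (Real.exp (-(κ * s l ^ 2) * ‖u‖ ^ 2))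
  let h : Fin G.numLines → MomentumSpace D → ℝ≥0∞ := fun l w =>
    ENNReal.ofReal (Real.exp (-(κ * (s l ^ 2)⁻¹) * ‖w‖ ^ 2))
  have hg : ∀ l, Measurable (g l) := fun l => by fun_prop
  have hh : ∀ l, Measurable (h l) := fun l => by fun_prop
  have hh1 : ∀ l w, h l w ≤ 1 := fun l w => by
    have := hs l
    rw [← ENNReal.ofReal_one]
    refine ENNReal.ofReal_le_ofReal (Real.exp_le_one_iff.2 ?_)
    rw [neg_mul, neg_nonpos]
    positivity
  have hgh : ∀ l p q, ‖((propagatorSlice Ω m M (μ l) p q : ℝ) : ℂ)‖ₑ ≤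
      g l (p + q) * h l (p - q) := fun l p q => by
    have := hs l
    rw [← ofReal_norm, Complex.norm_real,
      Real.norm_of_nonneg (propagatorSlice_nonneg hΩ hM _ p q)]
    simp only [g, h]
    rw [← ENNReal.ofReal_mul (by positivity), ← ENNReal.ofReal_mul (by positivity)]
    refine ENNReal.ofReal_le_ofReal ((hslice (μ l) p q).trans_eq ?_)
    rw [scaleGaussian, ← mul_assoc]
  have hgint : ∀ l, ∫⁻ u, g l u = ENNReal.ofReal (K * A * (s l ^ 2)⁻¹) := fun l => by
    have := hs l
    rw [lintegral_const_mul _ (by fun_prop), lintegral_exp_neg_mul_sq_norm (by positivity),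
      ← ENNReal.ofReal_mul (by positivity), ← div_div, div_eq_mul_inv (Real.pi / κ),
      Real.mul_rpow (by positivity) (by positivity), rpow_half_inv_sq (hs l), ← hA]
    congr 1
    field_simp
  have hhint : ∀ l, ∫⁻ w, h l w = ENNReal.ofReal (A * s l ^ D) := fun l => by
    have := hs l
    rw [lintegral_exp_neg_mul_sq_norm (by positivity), ← div_div,
      div_eq_mul_inv (Real.pi / κ) _, ← inv_pow, Real.mul_rpow (by positivity) (by positivity),
      rpow_half_inv_sq (inv_pos.2 (hs l)), inv_pow, inv_inv]
  calc ∫⁻ P, ‖G.integrand (fun l => propagatorSlice Ω m M (μ l)) φ P‖ₑ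
      ≤ ∫⁻ P : Fin G.numVert → Fin 3 → MomentumSpace D,
        (∏ l, g l (G.lineMomentum P l false + G.lineMomentum P l true)) *
        (∏ l ∈ B, h l (G.lineMomentum P l false - G.lineMomentum P l true)) *
        ∏ e, ‖fourierHat (φ e) (G.legMomentum P e)‖ₑ := by
        refine lintegral_mono fun P => ?_
        rw [integrand, enorm_mul, enorm_prod_eq, enorm_prod_eq]
        gcongr
        refine (Finset.prod_le_prod' fun l _ => hgh l _ _).trans ?_
        rw [Finset.prod_mul_distrib]
        refine mul_le_mul_right ?_ _
        exact Finset.prod_le_prod_of_subset_of_le_one' (Finset.subset_univ B)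
          fun l _ _ => hh1 l _
    _ ≤ c * ((∏ l, ∫⁻ u, g l u) * (∏ l ∈ B, ∫⁻ w, h l w) *
        ∏ e : Fin G.numLegs,
          eLpNorm (fourierHat (φ e)) (if (e : ℕ) + 2 < G.numLegs then 1 else 2) volume) :=
        hc g h (fun e => fourierHat (φ e)) hg hh fun e => measurable_fourierHat (φ e)
    _ = _ := by
        have hs' := fun l => (hs l).le
        simp only [hgint, hhint]
        rw [prod_eLpNorm_fourierHat, ← ENNReal.ofReal_prod_of_nonneg fun l _ => by positivity,
          ← ENNReal.ofReal_prod_of_nonneg fun l _ => by have := hs l; positivity,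
          ← ENNReal.ofReal_mul (Finset.prod_nonneg fun l _ => by positivity),
          ← ENNReal.ofReal_mul (by
            exact mul_nonneg (Finset.prod_nonneg fun l _ => by positivity)
              (Finset.prod_nonneg fun l _ => by have := hs l; positivity)),
          ← ENNReal.ofReal_coe_nnreal, ← ENNReal.ofReal_mul c.coe_nonneg]
        simp only [s, Finset.prod_mul_distrib, Finset.prod_const, Finset.card_univ,
          Fintype.card_fin]
        congr 1
        ring

/-- Power counting of the attributions: they are bounded by a geometric series in the scales. -/
theorem exists_lintegral_integrand_le (D : ℕ) {Ω m M : ℝ} (hΩ : 0 < Ω)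
    (hm : D = 0 → m ≠ 0) (hM : 1 < M) (hconn : G.IsConnected) (hconv : G.StronglyConvergent D)
    (hN : 2 ≤ G.numLegs) :
    ∃ K r : ℝ, 0 ≤ K ∧ 0 < r ∧ r < 1 ∧
      ∀ (μ : Fin G.numLines → ℕ) (φ : Fin G.numLegs → 𝓢(MomentumSpace D, ℂ)),
      ∫⁻ P, ‖G.integrand (fun l => propagatorSlice Ω m M (μ l)) φ P‖ₑ ≤
        ENNReal.ofReal (K * (∏ l, r ^ μ l) * legNorms φ) := by
  classical
  have hex : ∀ B : Finset (Fin G.numLines), ∃ K : ℝ, 0 ≤ K ∧ (G.IsLoopSet B →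
      ∀ (μ : Fin G.numLines → ℕ) (φ : Fin G.numLegs → 𝓢(MomentumSpace D, ℂ)),
      ∫⁻ P, ‖G.integrand (fun l => propagatorSlice Ω m M (μ l)) φ P‖ₑ ≤
        ENNReal.ofReal (K * ((∏ l, ((M ^ μ l) ^ 2)⁻¹) * ∏ l ∈ B, (M ^ μ l) ^ D) *
          legNorms φ)) := by
    intro B
    by_cases hB : G.IsLoopSet B
    · obtain ⟨K, hK, h⟩ := exists_lintegral_integrand_le_of_isLoopSet D hΩ hm hM hconn hN hB
      exact ⟨K, hK, fun _ => h⟩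
    · exact ⟨0, le_rfl, fun h => absurd h hB⟩
  choose K hK hbound using hex
  have hM0 : 0 < M := by linarith
  -- The decay `M ^ (-max μ)` is shared by all the lines, at the rate `t⁻¹ ^ μ l` for each.
  set t : ℝ := M ^ ((G.numLines + 1 : ℕ) : ℝ)⁻¹ with ht
  have ht1 : 1 < t := Real.one_lt_rpow hM (by positivity)
  have htM : t ^ (G.numLines + 1) = M := Real.rpow_inv_natCast_pow hM0.le (by omega)
  have ht0 : 0 < t := by linarith
  refine ⟨∑ B, K B, t⁻¹, Finset.sum_nonneg fun B _ => hK B, by positivity,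
    inv_lt_one_of_one_lt₀ ht1, fun μ φ => ?_⟩
  obtain ⟨B, hB, hcount⟩ := exists_isLoopSet_powerCounting hconv μ
  refine (hbound B hB μ φ).trans (ENNReal.ofReal_le_ofReal ?_)
  refine mul_le_mul_of_nonneg_right ?_ (legNorms_nonneg φ)
  refine mul_le_mul (Finset.single_le_sum (fun B _ => hK B) (Finset.mem_univ B)) ?_
    (mul_nonneg (Finset.prod_nonneg fun l _ => by positivity)
      (Finset.prod_nonneg fun l _ => by positivity)) (Finset.sum_nonneg fun B _ => hK B)
  have hsum : (G.numLines + 1) * (D * ∑ l ∈ B, μ l) + ∑ l, μ l ≤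
      (G.numLines + 1) * (2 * ∑ l, μ l) := by
    have h1 : D * ∑ l ∈ B, μ l ≤ 2 * ∑ l, μ l := by
      rcases isEmpty_or_nonempty (Fin G.numLines) with h | ⟨⟨l₀⟩⟩
      · have : B = ∅ := Finset.eq_empty_of_isEmpty B
        simp [this]
      · have := hcount l₀
        omega
    have h2 := Finset.sum_le_sum fun l (_ : l ∈ Finset.univ) => hcount l
    rw [Finset.sum_add_distrib, Finset.sum_const, Finset.sum_const, Finset.card_univ,
      Fintype.card_fin, smul_eq_mul, smul_eq_mul] at h2
    nlinarith
  simp only [inv_pow, Finset.prod_inv_distrib, ← pow_mul, Finset.prod_pow_eq_pow_sum,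
    ← Finset.sum_mul]
  rw [← htM, ← pow_mul, ← pow_mul, inv_mul_le_iff₀ (by positivity), ← div_eq_mul_inv,
    le_div_iff₀ (by positivity), ← pow_add]
  refine pow_le_pow_right₀ ht1.le ?_
  rw [mul_comm _ D, mul_comm _ 2]
  exact hsum

theorem sum_prod_geometric_le {ι : Type*} [Fintype ι] {r : ℝ} (hr : 0 < r) (hr1 : r < 1)
    (s : Finset (ι → ℕ)) : ∑ μ ∈ s, ∏ l, r ^ μ l ≤ ((1 - r)⁻¹) ^ Fintype.card ι := by
  classical
  obtain ⟨R, hR⟩ : ∃ R : ℕ, s ⊆ Fintype.piFinset fun _ : ι => Finset.range R := by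
    refine ⟨(s.sup fun μ => ∑ l, μ l) + 1, fun μ hμ => Fintype.mem_piFinset.2 fun l => ?_⟩
    have h1 := Finset.le_sup (f := fun μ : ι → ℕ => ∑ l, μ l) hμ
    have h2 := Finset.single_le_sum (f := μ) (fun _ _ => Nat.zero_le _) (Finset.mem_univ l)
    simp only [Finset.mem_range] at h1 ⊢
    omega
  calc ∑ μ ∈ s, ∏ l, r ^ μ l
      ≤ ∑ μ ∈ Fintype.piFinset fun _ : ι => Finset.range R, ∏ l, r ^ μ l :=
        Finset.sum_le_sum_of_subset_of_nonneg hR fun _ _ _ =>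
          Finset.prod_nonneg fun _ _ => by positivity
    _ = ∏ _l : ι, ∑ i ∈ Finset.range R, r ^ i := (Finset.prod_univ_sum _ _).symm
    _ ≤ ∏ _l : ι, (1 - r)⁻¹ := by
        refine Finset.prod_le_prod (fun _ _ => Finset.sum_nonneg fun _ _ => by positivity)
          fun _ _ => ?_
        rw [← tsum_geometric_of_lt_one hr.le hr1]
        exact (summable_geometric_of_lt_one hr.le hr1).sum_le_tsum _ fun _ _ => by positivity
    _ = _ := by rw [Finset.prod_const, Finset.card_univ]

/-- The amplitude with cutoff `ρ` collects the attributions of scales at most `ρ`. -/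
theorem integrand_propagatorCutoff {Ω m M : ℝ} (hΩ : 0 < Ω) (hm : D = 0 → m ≠ 0) (hM : 1 < M)
    (ρ : ℕ) (φ : Fin G.numLegs → 𝓢(MomentumSpace D, ℂ))
    (P : Fin G.numVert → Fin 3 → MomentumSpace D) :
    G.integrand (fun _ => propagatorCutoff Ω m M ρ) φ P =
      ∑ μ ∈ Fintype.piFinset fun _ : Fin G.numLines => Finset.range (ρ + 1),
        G.integrand (fun l => propagatorSlice Ω m M (μ l)) φ P := by
  simp only [integrand, propagatorCutoff_eq_sum hΩ hm hM, ← Finset.sum_mul]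
  congr 1
  simp only [← Complex.ofReal_prod, ← Complex.ofReal_sum]
  rw [Finset.prod_univ_sum]

end Phi4Graph

end Summation

theorem theorem2 (D : ℕ) (hD : D ≤ 4) (Ω m lam M : ℝ) (hΩ : 0 < Ω) (hm : D = 0 → m ≠ 0)
    (hM : 1 < M) (G : Phi4Graph) (hlegs : 0 < G.numLegs) (hconn : G.IsConnected)
    (hconv : G.StronglyConvergent D) :
    ∃ K : ℝ, 0 < K ∧ ∀ φ : Fin G.numLegs → 𝓢(MomentumSpace D, ℂ),
      (∀ μ : Fin G.numLines → ℕ,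
        Integrable (G.integrand (fun l => propagatorSlice Ω m M (μ l)) φ)) ∧
      (∀ ρ : ℕ, Integrable (G.integrand (fun _ => propagatorCutoff Ω m M ρ) φ)) ∧
      (Summable fun μ : Fin G.numLines → ℕ => G.attributionAmplitude Ω m M μ φ) ∧
      Tendsto (fun ρ : ℕ => G.cutoffAmplitude Ω m lam M ρ φ) atTop
        (𝓝 (G.fullAmplitude Ω m lam M φ)) ∧
      (∀ ρ : ℕ, ‖G.cutoffAmplitude Ω m lam M ρ φ‖ ≤ K * legNorms φ) ∧
      ‖G.fullAmplitude Ω m lam M φ‖ ≤ K * legNorms φ := by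
  obtain ⟨K, r, hK, hr, hr1, hbound⟩ := Phi4Graph.exists_lintegral_integrand_le D hΩ hm hM hconn
    hconv (G.two_le_numLegs hlegs)
  have hr1' : 0 < 1 - r := by linarith
  set S : ℝ := ((1 - r)⁻¹) ^ G.numLines with hS
  refine ⟨|G.prefactor D lam| * (K * S) + 1, by positivity, fun φ => ?_⟩
  have hint : ∀ μ : Fin G.numLines → ℕ,
      Integrable (G.integrand (fun l => propagatorSlice Ω m M (μ l)) φ) := fun μ =>
    ⟨(Phi4Graph.measurable_integrand
      (fun l => measurable_propagatorOn D Ω m _) φ).aestronglyMeasurable,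
      (hbound μ φ).trans_lt ENNReal.ofReal_lt_top⟩
  have hcut : ∀ ρ, G.integrand (fun _ => propagatorCutoff Ω m M ρ) φ = fun P =>
      ∑ μ ∈ Fintype.piFinset fun _ : Fin G.numLines => Finset.range (ρ + 1),
        G.integrand (fun l => propagatorSlice Ω m M (μ l)) φ P := fun ρ =>
    funext fun P => Phi4Graph.integrand_propagatorCutoff hΩ hm hM ρ φ P
  have hamp : ∀ ρ, G.cutoffAmplitude Ω m lam M ρ φ = (G.prefactor D lam : ℂ) *
      ∑ μ ∈ Fintype.piFinset fun _ : Fin G.numLines => Finset.range (ρ + 1),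
        G.attributionAmplitude Ω m M μ φ := fun ρ => by
    rw [Phi4Graph.cutoffAmplitude, Phi4Graph.feynmanIntegral, hcut,
      integral_finsetSum _ fun μ _ => hint μ]
    rfl
  have hnorm : ∀ μ, ‖G.attributionAmplitude Ω m M μ φ‖ ≤ K * (∏ l, r ^ μ l) * legNorms φ := by
    intro μ
    have hnn : 0 ≤ K * (∏ l, r ^ μ l) * legNorms φ :=
      mul_nonneg (mul_nonneg hK (Finset.prod_nonneg fun _ _ => by positivity)) (legNorms_nonneg φ)
    rw [← ENNReal.ofReal_le_ofReal_iff hnn, ofReal_norm]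
    exact (enorm_integral_le_lintegral_enorm _).trans (hbound μ φ)
  have hpart : ∀ s : Finset (Fin G.numLines → ℕ),
      ∑ μ ∈ s, ‖G.attributionAmplitude Ω m M μ φ‖ ≤ K * S * legNorms φ := by
    intro s
    refine (Finset.sum_le_sum fun μ _ => hnorm μ).trans ?_
    rw [← Finset.sum_mul, ← Finset.mul_sum]
    refine mul_le_mul_of_nonneg_right (mul_le_mul_of_nonneg_left ?_ hK) (legNorms_nonneg φ)
    have h := Phi4Graph.sum_prod_geometric_le (ι := Fin G.numLines) hr hr1 s
    rwa [Fintype.card_fin] at h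
  have hsumm : Summable fun μ => ‖G.attributionAmplitude Ω m M μ φ‖ :=
    summable_of_sum_le (fun _ => norm_nonneg _) hpart
  have hcbound : ∀ z : ℂ, ‖z‖ ≤ K * S * legNorms φ →
      ‖(G.prefactor D lam : ℂ) * z‖ ≤ (|G.prefactor D lam| * (K * S) + 1) * legNorms φ := by
    intro z hz
    rw [norm_mul, Complex.norm_real, Real.norm_eq_abs]
    have := mul_le_mul_of_nonneg_left hz (abs_nonneg (G.prefactor D lam))
    linarith [legNorms_nonneg φ]
  refine ⟨hint, fun ρ => ?_, hsumm.of_norm, ?_, fun ρ => ?_, ?_⟩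
  · rw [hcut]
    exact integrable_finsetSum _ fun μ _ => hint μ
  · simp only [hamp]
    refine Tendsto.const_mul _ (hsumm.of_norm.hasSum.comp ?_)
    refine tendsto_atTop_finset_of_monotone (fun ρ ρ' h => Fintype.piFinset_subset _ _ fun _ =>
      Finset.range_subset_range.2 (by omega)) fun μ =>
        ⟨∑ l, μ l, Fintype.mem_piFinset.2 fun l => ?_⟩
    have := Finset.single_le_sum (f := μ) (fun _ _ => Nat.zero_le _) (Finset.mem_univ l)
    rw [Finset.mem_range]
    omega
  · rw [hamp]
    exact hcbound _ ((norm_sum_le _ _).trans (hpart _))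
  · exact hcbound _ ((norm_tsum_le_tsum_norm hsumm).trans
      (hsumm.tsum_le_of_sum_le hpart))
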